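/- Let $\sigma^{(1)}=\begin{pmatrix}0&1\\1&0\end{pmatrix}$, $\sigma^{(2)}=\begin{pmatrix}0&-i\\i&0\end{pmatrix}$, $\sigma^{(3)}=\begin{pmatrix}1&0\\0&-1\end{pmatrix}$ be the Pauli matrices, and for $n\ge 2$, $1\le j\le n$, $1\le a\le 3$ let $\sigma^{(a)}_j=I_2^{\otimes(j-1)}\otimes\sigma^{(a)}\otimes I_2^{\otimes(n-j)}$, with cyclic labelling $\sigma^{(a)}_{n+1}=\sigma^{(a)}_1$. For $x=(x_{a,b,j})\in\mathbb{R}^{9n}$ ($1\le a,b\le 3$, $1\le j\le n$) consider the Hermitian $2^n\times 2^n$ matrix \[H_n=\sum_{j=1}^n\sum_{a,b=1}^3 x_{a,b,j}\,\sigma^{(a)}_j\sigma^{(b)}_{j+1}\] with eigenvalues $\lambda_1\le\dots\le\lambda_{2^n}$ (counted with multiplicity), and its spectral measure $\mu_n=2^{-n}\sum_{k=1}^{2^n}\delta_{\lambda_k}$. Let the coefficient vector $x$ be random, uniformly distributed on the unit sphere $S^{9n-1}\subset\mathbb{R}^{9n}$, and let $\mu_n^{DOS}=\mathbb{E}\mu_n$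 be the density of states measure, i.e. $\mu_n^{DOS}(A)=\mathbb{E}[\mu_n(A)]$ for Borel sets $A\subseteq\mathbb{R}$. For probability measures $\mu,\nu$ on $\mathbb{R}$ let \[d_{BL}(\mu,\nu)=\sup\left\{\left|\int f\,d\mu-\int f\,d\nu\right| : \|f\|_\infty+|f|_L\le 1\right\},\] where $|f|_L$ is the Lipschitz constant of $f:\mathbb{R}\to\mathbb{R}$. Then there are universal constants $C,C',c>0$ such that \begin{enumerate} \item[(a)] for all $n\ge 2$, $\displaystyle\mathbb{E}\,d_{BL}(\mu_n,\mu_n^{DOS})\le \frac{C}{n^{1/6}}$; \item[(b)] for all $n\ge 2$ and all $t\ge 0$, $\displaystyle\mathbb{P}\left[d_{BL}(\mu_n,\mu_n^{DOS})\ge\frac{C}{n^{1/6}}+t\right]\le Ce^{-cnt^2}$; \item[(c)] whatever the joint distribution of the coefficient vectors for different $n$, with probability $1$, $\displaystyle d_{BL}(\mu_n,\mu_n^{DOS})\le\frac{C'}{n^{1/6}}$ for all sufficiently large $n$. \end{enumerate} -/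

import Mathlib

open MeasureTheory ProbabilityTheory Filter
open scoped ENNReal NNReal Topology

namespace SpinChain

noncomputable section

/-! ### The Hamiltonian -/

/-- The three non-trivial Pauli matrices. -/
def pauli : Fin 3 → Matrix (Fin 2) (Fin 2) ℂ :=
  ![!![0, 1; 1, 0], !![0, -Complex.I; Complex.I, 0], !![1, 0; 0, -1]]

/-- The Kronecker product `M 0 ⊗ M 1 ⊗ ⋯ ⊗ M (n - 1)` of `n` complex `2 × 2` matrices, a
`2 ^ n × 2 ^ n` matrix whose rows and columns are indexed by `Fin n → Fin 2`. -/
def tensor {n : ℕ} (M : Fin n → Matrix (Fin 2) (Fin 2) ℂ) :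
    Matrix (Fin n → Fin 2) (Fin n → Fin 2) ℂ :=
  Matrix.of fun s t => ∏ k, M k (s k) (t k)

/-- `I ⊗ ⋯ ⊗ I ⊗ σ⁽ᵃ⁾ ⊗ I ⊗ ⋯ ⊗ I`, with the Pauli matrix `σ⁽ᵃ⁾` in position `j`. -/
def site (n : ℕ) (a : Fin 3) (j : Fin n) : Matrix (Fin n → Fin 2) (Fin n → Fin 2) ℂ :=
  tensor (Function.update (fun _ => 1) j (pauli a))

/-- The space `ℝ^{9n}` of coefficient vectors `(x_{a,b,j})`, with the Euclidean norm. -/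
abbrev Coeff (n : ℕ) : Type := EuclideanSpace ℝ (Fin 3 × Fin 3 × Fin n)

/-- `H_n(x) = ∑_j ∑_{a,b} x_{a,b,j} σ⁽ᵃ⁾_j σ⁽ᵇ⁾_{j+1}`; `finRotate n` is the cyclic shift
`j ↦ j + 1` of the sites. -/
def hamiltonian (n : ℕ) (x : Coeff n) : Matrix (Fin n → Fin 2) (Fin n → Fin 2) ℂ :=
  ∑ j : Fin n, ∑ a : Fin 3, ∑ b : Fin 3,
    (x (a, b, j) : ℂ) • (site n a j * site n b (finRotate n j))

theorem pauli_isHermitian (a : Fin 3) : (pauli a).IsHermitian := by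
  fin_cases a <;> ext i j <;> fin_cases i <;> fin_cases j <;>
    simp [pauli, Matrix.conjTranspose_apply]

theorem tensor_mul {n : ℕ} (M N : Fin n → Matrix (Fin 2) (Fin 2) ℂ) :
    tensor M * tensor N = tensor (fun k => M k * N k) := by
  ext s t
  simp only [tensor, Matrix.mul_apply, Matrix.of_apply, ← Finset.prod_mul_distrib]
  exact (Fintype.prod_sum (fun k i => M k (s k) i * N k i (t k))).symm

theorem tensor_conjTranspose {n : ℕ} (M : Fin n → Matrix (Fin 2) (Fin 2) ℂ) :
    (tensor M).conjTranspose = tensor (fun k => (M k).conjTranspose) := by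
  ext s t
  simp [tensor, Matrix.conjTranspose_apply]

theorem site_isHermitian (n : ℕ) (a : Fin 3) (j : Fin n) : (site n a j).IsHermitian := by
  unfold Matrix.IsHermitian site
  rw [tensor_conjTranspose]
  congr 1
  funext k
  by_cases h : k = j
  · subst h; simpa using (pauli_isHermitian a).eq
  · simp [Function.update_of_ne h]

theorem site_commute {n : ℕ} (a b : Fin 3) {i j : Fin n} (h : i ≠ j) :
    Commute (site n a i) (site n b j) := by
  unfold Commute SemiconjBy site
  rw [tensor_mul, tensor_mul]
  congr 1
  funext k
  by_cases hi : k = i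
  · subst hi; simp [Function.update_of_ne h]
  · simp [Function.update_of_ne hi]

theorem finRotate_ne {n : ℕ} (hn : 2 ≤ n) (j : Fin n) : j ≠ finRotate n j := by
  have := j.neZero
  rw [finRotate_apply]
  intro h
  have h1 := congrArg Fin.val h
  have hj := j.isLt
  rw [Fin.val_add_one_of_lt'] at h1
  · omega
  · by_contra hc
    have : (j : ℕ) + 1 = n := by omega
    rw [Fin.val_add] at h1
    have e : ((1 : Fin n) : ℕ) = 1 := by
      rw [Fin.val_one', Nat.mod_eq_of_lt (by omega)]
    rw [e, this, Nat.mod_self] at h1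
    omega

theorem hamiltonian_isHermitian {n : ℕ} (hn : 2 ≤ n) (x : Coeff n) :
    (hamiltonian n x).IsHermitian := by
  unfold Matrix.IsHermitian hamiltonian
  simp only [Matrix.conjTranspose_sum, Matrix.conjTranspose_smul, Matrix.conjTranspose_mul,
    (site_isHermitian n _ _).eq]
  refine Finset.sum_congr rfl fun j _ => Finset.sum_congr rfl fun a _ =>
    Finset.sum_congr rfl fun b _ => ?_
  rw [(site_commute b a (finRotate_ne hn j).symm).eq]
  simp

/-! ### Spectral measures -/

/-- The spectral measure of a Hermitian matrix: equal mass at each eigenvalue, counted with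
multiplicity. -/
def spectralMeasure {ι : Type} [Fintype ι] [DecidableEq ι] {A : Matrix ι ι ℂ}
    (hA : A.IsHermitian) : Measure ℝ :=
  (Fintype.card ι : ℝ≥0∞)⁻¹ • ∑ i, Measure.dirac (hA.eigenvalues i)

theorem sum_eval_eigenvalues {ι : Type} [Fintype ι] [DecidableEq ι] {A : Matrix ι ι ℂ}
    (hA : A.IsHermitian) (p : Polynomial ℝ) :
    ∑ i, p.eval (hA.eigenvalues i) = ((p.map (algebraMap ℝ ℂ)).aeval A).trace.re := by
  induction p using Polynomial.induction_on' with
  | add p q hp hq => simp [Finset.sum_add_distrib, hp, hq, Matrix.trace_add]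
  | monomial k r =>
    have h : (A ^ k).trace = ∑ i, ((hA.eigenvalues i : ℂ)) ^ k := by
      conv_lhs => rw [hA.spectral_theorem, ← map_pow, Unitary.conjStarAlgAut_apply,
        Matrix.trace_mul_cycle]
      simp [Matrix.diagonal_pow, Matrix.trace_diagonal]
    simp only [Polynomial.eval_monomial, Polynomial.map_monomial, Polynomial.aeval_monomial]
    rw [← Algebra.smul_def, Matrix.trace_smul, h, ← Finset.mul_sum]
    simp [← Complex.ofReal_pow, ← Complex.ofReal_sum]

instance spectralMeasure_prob {ι : Type} [Fintype ι] [DecidableEq ι] [Nonempty ι] {A : Matrix ι ι ℂ}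
    (hA : A.IsHermitian) : IsProbabilityMeasure (spectralMeasure hA) := by
  refine ⟨?_⟩
  simp [spectralMeasure, ENNReal.inv_mul_cancel]

theorem measurable_spectralMeasure {α ι : Type} [MeasurableSpace α] [Fintype ι] [DecidableEq ι]
    [Nonempty ι] {A : α → Matrix ι ι ℂ} (hm : ∀ i j, Measurable fun x => A x i j)
    (hA : ∀ x, (A x).IsHermitian) : Measurable fun x => spectralMeasure (hA x) := by
  have hpow : ∀ k : ℕ, ∀ i j, Measurable fun x => (A x ^ k) i j := by
    intro k
    induction k with
    | zero => intro i j; simp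
    | succ k ih =>
      intro i j
      simp only [pow_succ, Matrix.mul_apply]
      exact Finset.measurable_sum _ fun l _ => (ih i l).mul (hm l j)
  have hpoly : ∀ p : Polynomial ℝ, Measurable fun x => ∑ i, p.eval ((hA x).eigenvalues i) := by
    intro p
    simp only [sum_eval_eigenvalues, Polynomial.aeval_eq_sum_range, Matrix.trace, Matrix.diag_apply,
      Matrix.sum_apply, Matrix.smul_apply, smul_eq_mul]
    refine Complex.measurable_re.comp ?_
    exact Finset.measurable_sum _ fun i _ => Finset.measurable_sum _ fun l _ =>
      (hpow l i i).const_mul _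
  have hcont : ∀ f : ℝ → ℝ, Continuous f →
      Measurable fun x => ∑ i, f ((hA x).eigenvalues i) := by
    intro f hf
    have hp : ∀ k : ℕ, ∃ p : Polynomial ℝ, ∀ y ∈ Set.Icc (-(k : ℝ)) k,
        |p.eval y - f y| < 1 / ((k : ℝ) + 1) := fun k =>
      exists_polynomial_near_of_continuousOn _ _ f hf.continuousOn _ (by positivity)
    choose p hp using hp
    have hlim : ∀ y : ℝ, Tendsto (fun k => (p k).eval y) atTop (𝓝 (f y)) := by
      intro y
      rw [tendsto_iff_dist_tendsto_zero]
      refine squeeze_zero' (Eventually.of_forall fun _ => dist_nonneg) ?_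
        (tendsto_one_div_add_atTop_nhds_zero_nat (𝕜 := ℝ))
      obtain ⟨K, hK⟩ := exists_nat_ge |y|
      filter_upwards [eventually_ge_atTop K] with k hk
      have : |y| ≤ k := hK.trans (by exact_mod_cast hk)
      exact (hp k y (by rwa [Set.mem_Icc, ← abs_le])).le
    exact measurable_of_tendsto_metrizable (fun k => hpoly (p k))
      (tendsto_pi_nhds.2 fun x => tendsto_finsetSum _ fun i _ => hlim _)
  have hind : ∀ t : ℝ, Measurable fun x =>
      ∑ i, (Set.Iic t).indicator (fun _ => (1 : ℝ)) ((hA x).eigenvalues i) := by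
    intro t
    have hlim : ∀ y : ℝ, Tendsto (fun k : ℕ => max 0 (1 - (k : ℝ) * max 0 (y - t))) atTop
        (𝓝 ((Set.Iic t).indicator (fun _ => (1 : ℝ)) y)) := by
      intro y
      rcases le_or_gt y t with h | h
      · simp [Set.indicator_of_mem (Set.mem_Iic.2 h), max_eq_left (sub_nonpos.2 h)]
      · rw [Set.indicator_of_notMem (by simpa using h)]
        refine tendsto_const_nhds.congr' ?_
        obtain ⟨K, hK⟩ := exists_nat_ge (1 / (y - t))
        filter_upwards [eventually_ge_atTop K] with k hk
        have h0 : 0 < y - t := sub_pos.2 h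
        have : 1 / (y - t) ≤ k := hK.trans (by exact_mod_cast hk)
        rw [div_le_iff₀ h0] at this
        rw [max_eq_right h0.le, max_eq_left (by linarith)]
    exact measurable_of_tendsto_metrizable
      (fun k => hcont (fun y => max 0 (1 - (k : ℝ) * max 0 (y - t))) (by fun_prop))
      (tendsto_pi_nhds.2 fun x => tendsto_finsetSum _ fun i _ => hlim _)
  refine .measure_of_isPiSystem_of_isProbabilityMeasure (borel_eq_generateFrom_Iic ℝ)
    isPiSystem_Iic ?_
  rintro _ ⟨t, rfl⟩
  have h : ∀ x, spectralMeasure (hA x) (Set.Iic t) = (Fintype.card ι : ℝ≥0∞)⁻¹ *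
      ENNReal.ofReal (∑ i, (Set.Iic t).indicator (fun _ => (1 : ℝ)) ((hA x).eigenvalues i)) := by
    intro x
    rw [ENNReal.ofReal_sum_of_nonneg fun i _ => Set.indicator_nonneg (fun _ _ => zero_le_one) _]
    simp only [spectralMeasure, Measure.smul_apply, Measure.finsetSum_apply, smul_eq_mul]
    congr 1
    refine Finset.sum_congr rfl fun i _ => ?_
    rw [Measure.dirac_apply' _ measurableSet_Iic]
    by_cases hi : (hA x).eigenvalues i ∈ Set.Iic t <;> simp [hi]
  simp only [h]
  exact ((hind t).ennreal_ofReal).const_mul _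

/-- The empirical spectral measure `μ_n` of `H_n(x)`. -/
def empirical {n : ℕ} (hn : 2 ≤ n) (x : Coeff n) : Measure ℝ :=
  spectralMeasure (hamiltonian_isHermitian hn x)

theorem measurable_empirical {n : ℕ} (hn : 2 ≤ n) : Measurable (empirical hn) := by
  refine measurable_spectralMeasure (fun s t => ?_) _
  simp only [hamiltonian, Matrix.sum_apply, Matrix.smul_apply]
  fun_prop

/-- The uniform probability measure on the unit sphere `S^{9n-1}`, as a measure on `ℝ^{9n}`. -/
def sphereLaw (n : ℕ) : Measure (Coeff n) :=
  (((volume : Measure (Coeff n)).toSphere Set.univ)⁻¹ •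
    (volume : Measure (Coeff n)).toSphere).map Subtype.val

theorem sphereLaw_prob {n : ℕ} (hn : 2 ≤ n) : IsProbabilityMeasure (sphereLaw n) := by
  have : NeZero n := ⟨by omega⟩
  have h0 : (volume : Measure (Coeff n)).toSphere Set.univ ≠ 0 := by
    rw [Ne, Measure.measure_univ_eq_zero]; exact Measure.toSphere_ne_zero _
  refine ⟨?_⟩
  rw [sphereLaw, Measure.map_apply measurable_subtype_coe .univ]
  exact ENNReal.inv_mul_cancel h0 (measure_ne_top _ _)

/-- The density of states measure, `μ_n^{DOS}(A) = 𝔼 μ_n(A)`. -/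
def dos {n : ℕ} (hn : 2 ≤ n) : Measure ℝ :=
  (sphereLaw n).bind (empirical hn)

theorem dos_prob {n : ℕ} (hn : 2 ≤ n) : IsProbabilityMeasure (dos hn) := by
  have := sphereLaw_prob hn
  refine ⟨?_⟩
  rw [dos, Measure.bind_apply .univ (measurable_empirical hn).aemeasurable]
  simp [empirical]

theorem dos_apply {n : ℕ} (hn : 2 ≤ n) {s : Set ℝ} (hs : MeasurableSet s) :
    dos hn s = ∫⁻ x, empirical hn x s ∂(sphereLaw n) :=
  Measure.bind_apply hs (measurable_empirical hn).aemeasurable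

/-! ### The bounded-Lipschitz distance -/

/-- `‖f‖_{BL} = ‖f‖_∞ + |f|_L`, with value `∞` if `f` is not bounded or not Lipschitz. -/
def blNorm (f : ℝ → ℝ) : ℝ≥0∞ :=
  (⨆ x, ‖f x‖ₑ) + ⨅ (K : ℝ≥0) (_ : LipschitzWith K f), (K : ℝ≥0∞)

/-- The bounded-Lipschitz distance between probability measures on `ℝ`. -/
def dBL (μ ν : Measure ℝ) : ℝ :=
  sSup {d : ℝ | ∃ f : ℝ → ℝ, blNorm f ≤ 1 ∧ d = |∫ x, f x ∂μ - ∫ x, f x ∂ν|}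

end

end SpinChain

/-!
For a Gaussian measure, the rotation `(x, y) ↦ (cos θ • x + sin θ • y, cos θ • y - sin θ • x)` of
two independent copies interpolates between them, and Jensen's inequality along it shows that a
Lipschitz function is sub-Gaussian around its mean. On the sphere, a Lipschitz function `F` with
mean zero has the Lipschitz extension `x ↦ ‖x‖ F (x / ‖x‖)`; the norm and the direction of a
Gaussian vector are independent, so Jensen's inequality in the radius transfers the bound to `F`.

The map `x ↦ ∫ f dμ_n` is Lipschitz because the squared overlaps of two eigenbases form a doubly
stochastic matrix, which couples the two spectra at a cost given by the normalized Hilbert–Schmidt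
norm, and the Pauli strings in `H_n` are orthogonal for that norm. The constants are therefore
dimension free, and concentration happens at scale `n ^ (-1/2)` for each test function `f`.

The second moments of `μ_n` and of the density of states are bounded, so up to a small error the
bounded-Lipschitz distance only sees `k` ramp functions on a grid of `[-R, R]`; this gives the bound
in expectation. The distance itself is Lipschitz in `x`, which gives the tail bound, and the
Borel–Cantelli lemma gives the almost sure bound.
-/

open Module

section ExpMoments

variable {Ω : Type*} [MeasurableSpace Ω] {μ : Measure Ω} {X : Ω → ℝ} {c : ℝ≥0}

theorem ofReal_exp_integral_le_lintegral_exp [IsProbabilityMeasure μ] (hX : Integrable X μ) :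
    ENNReal.ofReal (Real.exp (∫ ω, X ω ∂μ)) ≤ ∫⁻ ω, ENNReal.ofReal (Real.exp (X ω)) ∂μ := by
  have hpos : 0 ≤ᵐ[μ] fun ω => Real.exp (X ω) := ae_of_all _ fun _ => (Real.exp_pos _).le
  by_cases hi : Integrable (fun ω => Real.exp (X ω)) μ
  · rw [← ofReal_integral_eq_lintegral_ofReal hi hpos]
    exact ENNReal.ofReal_le_ofReal (convexOn_exp.map_integral_le
      Real.continuous_exp.continuousOn isClosed_univ (ae_of_all _ fun _ => Set.mem_univ _) hX hi)
  · have htop : ∫⁻ ω, ENNReal.ofReal (Real.exp (X ω)) ∂μ = ∞ := by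
      by_contra h
      exact hi ⟨Real.continuous_exp.comp_aestronglyMeasurable hX.aestronglyMeasurable,
        (hasFiniteIntegral_iff_ofReal hpos).2 (lt_top_iff_ne_top.2 h)⟩
    exact le_top.trans_eq htop.symm

theorem hasSubgaussianMGF_of_lintegral_exp_le (hX : AEMeasurable X μ)
    (h : ∀ t : ℝ, ∫⁻ ω, ENNReal.ofReal (Real.exp (t * X ω)) ∂μ ≤
      ENNReal.ofReal (Real.exp (c * t ^ 2 / 2))) :
    HasSubgaussianMGF X c μ := by
  have hpos : ∀ t : ℝ, 0 ≤ᵐ[μ] fun ω => Real.exp (t * X ω) :=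
    fun t => ae_of_all _ fun _ => (Real.exp_pos _).le
  have hi : ∀ t : ℝ, Integrable (fun ω => Real.exp (t * X ω)) μ := fun t =>
    ⟨(hX.const_mul t).exp.aestronglyMeasurable,
      (hasFiniteIntegral_iff_ofReal (hpos t)).2 ((h t).trans_lt ENNReal.ofReal_lt_top)⟩
  refine ⟨hi, fun t => (ENNReal.ofReal_le_ofReal_iff (Real.exp_pos _).le).1 ?_⟩
  rw [mgf, ofReal_integral_eq_lintegral_ofReal (hi t) (hpos t)]
  exact h t

theorem lintegral_exp_mul_le_of_hasSubgaussianMGF (hX : HasSubgaussianMGF X c μ) (t : ℝ) :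
    ∫⁻ ω, ENNReal.ofReal (Real.exp (t * X ω)) ∂μ ≤ ENNReal.ofReal (Real.exp (c * t ^ 2 / 2)) := by
  rw [← ofReal_integral_eq_lintegral_ofReal (hX.integrable_exp_mul t)
    (ae_of_all _ fun _ => (Real.exp_pos _).le)]
  exact ENNReal.ofReal_le_ofReal (hX.mgf_le t)

theorem mul_integral_abs_le_of_hasSubgaussianMGF [IsProbabilityMeasure μ]
    (hX : HasSubgaussianMGF X c μ) (s : ℝ) :
    s * ∫ ω, |X ω| ∂μ ≤ 2 * Real.exp (c * s ^ 2 / 2) - 1 := by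
  have hpt : ∀ y : ℝ, 1 + s * |y| ≤ Real.exp (s * y) + Real.exp (-s * y) := by
    intro y
    rcases abs_cases y with ⟨h, _⟩ | ⟨h, _⟩ <;> rw [h]
    · linarith [Real.add_one_le_exp (s * y), Real.exp_pos (-s * y)]
    · linarith [Real.add_one_le_exp (-s * y), Real.exp_pos (s * y)]
  have hleft : Integrable (fun ω => s * |X ω|) μ := hX.integrable.abs.const_mul s
  have hsum : 1 + s * ∫ ω, |X ω| ∂μ ≤
      Real.exp (c * s ^ 2 / 2) + Real.exp (c * s ^ 2 / 2) := by
    calc 1 + s * ∫ ω, |X ω| ∂μ = ∫ ω, (1 + s * |X ω|) ∂μ := by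
          rw [integral_add (integrable_const _) hleft, integral_const_mul, integral_const,
            probReal_univ, one_smul]
      _ ≤ ∫ ω, (Real.exp (s * X ω) + Real.exp (-s * X ω)) ∂μ :=
          integral_mono ((integrable_const _).add hleft)
            ((hX.integrable_exp_mul s).add (hX.integrable_exp_mul (-s))) fun ω => hpt _
      _ ≤ Real.exp (c * s ^ 2 / 2) + Real.exp (c * s ^ 2 / 2) := by
          rw [integral_add (hX.integrable_exp_mul s) (hX.integrable_exp_mul (-s))]
          exact add_le_add (hX.mgf_le s) (neg_sq s ▸ hX.mgf_le (-s))
  linarith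

theorem integral_abs_le_of_hasSubgaussianMGF [IsProbabilityMeasure μ]
    (hX : HasSubgaussianMGF X c μ) (hc : 0 < c) : ∫ ω, |X ω| ∂μ ≤ 3 * √c := by
  have hs : 0 < √(c : ℝ) := Real.sqrt_pos.2 (NNReal.coe_pos.2 hc)
  have hcs : c * (√(c : ℝ))⁻¹ ^ 2 = 1 := by
    rw [inv_pow, Real.sq_sqrt (NNReal.coe_nonneg c)]
    exact mul_inv_cancel₀ (NNReal.coe_pos.2 hc).ne'
  have hexp : Real.exp (1 / 2) ≤ 2 := by
    rw [← Real.le_log_iff_exp_le two_pos]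
    linarith [Real.log_two_gt_d9]
  have h := mul_integral_abs_le_of_hasSubgaussianMGF hX (√(c : ℝ))⁻¹
  rw [hcs, inv_mul_le_iff₀ hs] at h
  calc ∫ ω, |X ω| ∂μ ≤ √c * (2 * Real.exp (1 / 2) - 1) := h
    _ ≤ √c * 3 := by gcongr; linarith
    _ = 3 * √c := mul_comm _ _

end ExpMoments

section GaussianDensity

variable (E : Type*) [NormedAddCommGroup E] [InnerProductSpace ℝ E]

/-- The density of the standard Gaussian measure of `E`, as a function of the distance to the
origin. -/
noncomputable def stdGaussianRadialDensity (r : ℝ) : ℝ :=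
  (2 * Real.pi) ^ (-(finrank ℝ E / 2 : ℝ)) * Real.exp (-(1 / 2) * r ^ 2)

variable {E}

theorem stdGaussianRadialDensity_nonneg (r : ℝ) : 0 ≤ stdGaussianRadialDensity E r := by
  unfold stdGaussianRadialDensity; positivity

theorem continuous_stdGaussianRadialDensity : Continuous (stdGaussianRadialDensity E) := by
  unfold stdGaussianRadialDensity; fun_prop

variable [FiniteDimensional ℝ E] [MeasurableSpace E] [BorelSpace E]

theorem integral_stdGaussianRadialDensity_norm_mul_exp {s : ℝ} (hs : 0 ≤ s) :
    ∫ x : E, stdGaussianRadialDensity E ‖x‖ * Real.exp (-s * ‖x‖ ^ 2) =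
      (1 + 2 * s) ^ (-(finrank ℝ E / 2 : ℝ)) := by
  have h : ∀ x : E, stdGaussianRadialDensity E ‖x‖ * Real.exp (-s * ‖x‖ ^ 2) =
      (2 * Real.pi) ^ (-(finrank ℝ E / 2 : ℝ)) * Real.exp (-(1 / 2 + s) * ‖x‖ ^ 2) := by
    intro x
    rw [stdGaussianRadialDensity, mul_assoc, ← Real.exp_add]
    ring_nf
  simp_rw [h]
  rw [integral_const_mul, GaussianFourier.integral_rexp_neg_mul_sq_norm (by positivity),
    Real.rpow_neg (by positivity), Real.rpow_neg (by positivity), ← Real.inv_rpow (by positivity),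
    ← Real.inv_rpow (by positivity), ← Real.mul_rpow (by positivity) (by positivity)]
  congr 1
  have := Real.pi_ne_zero
  field_simp

theorem integral_stdGaussianRadialDensity_norm : ∫ x : E, stdGaussianRadialDensity E ‖x‖ = 1 := by
  simpa using integral_stdGaussianRadialDensity_norm_mul_exp (E := E) le_rfl

theorem integrable_stdGaussianRadialDensity_norm :
    Integrable fun x : E => stdGaussianRadialDensity E ‖x‖ :=
  .of_integral_ne_zero (by simp [integral_stdGaussianRadialDensity_norm])

theorem integral_stdGaussianRadialDensity_norm_mul_cexp_inner (t : E) :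
    ∫ x : E, (stdGaussianRadialDensity E ‖x‖ : ℂ) * Complex.exp (inner ℝ x t * Complex.I) =
      Complex.exp (-‖t‖ ^ 2 / 2) := by
  have h : ∀ x : E,
      (stdGaussianRadialDensity E ‖x‖ : ℂ) * Complex.exp (inner ℝ x t * Complex.I) =
        ((2 * Real.pi) ^ (-(finrank ℝ E / 2 : ℝ)) : ℝ) *
          Complex.exp (-(1 / 2) * ‖x‖ ^ 2 + Complex.I * inner ℝ t x) := by
    intro x
    rw [stdGaussianRadialDensity, Complex.exp_add, real_inner_comm, mul_comm Complex.I]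
    push_cast
    ring
  have hnorm : (((2 * Real.pi) ^ (-(finrank ℝ E / 2 : ℝ)) : ℝ) : ℂ) *
      ((Real.pi : ℂ) / (1 / 2)) ^ ((finrank ℝ E : ℂ) / 2) = 1 := by
    rw [show (Real.pi : ℂ) / (1 / 2) = ((2 * Real.pi : ℝ) : ℂ) by push_cast; ring,
      show (finrank ℝ E : ℂ) / 2 = ((finrank ℝ E / 2 : ℝ) : ℂ) by push_cast; ring,
      ← Complex.ofReal_cpow (by positivity), ← Complex.ofReal_mul, Real.rpow_neg (by positivity),
      inv_mul_cancel₀ (by positivity), Complex.ofReal_one]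
  simp_rw [h]
  rw [integral_const_mul, GaussianFourier.integral_cexp_neg_mul_sq_norm_add (b := (1 / 2 : ℂ))
    (by norm_num) Complex.I t, ← mul_assoc, hnorm, one_mul, Complex.I_sq]
  congr 1
  ring

theorem stdGaussian_eq_withDensity :
    stdGaussian E = (volume : Measure E).withDensity
      fun x => ENNReal.ofReal (stdGaussianRadialDensity E ‖x‖) := by
  have : IsFiniteMeasure ((volume : Measure E).withDensity
      fun x => ENNReal.ofReal (stdGaussianRadialDensity E ‖x‖)) :=
    isFiniteMeasure_withDensity_ofReal integrable_stdGaussianRadialDensity_norm.2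
  have hm : Measurable fun x : E => ENNReal.ofReal (stdGaussianRadialDensity E ‖x‖) :=
    (continuous_stdGaussianRadialDensity.measurable.comp measurable_norm).ennreal_ofReal
  refine Measure.ext_of_charFun (funext fun t => ?_)
  rw [charFun_stdGaussian, charFun_apply, integral_withDensity_eq_integral_toReal_smul hm (by simp),
    ← integral_stdGaussianRadialDensity_norm_mul_cexp_inner t]
  refine integral_congr_ae (ae_of_all _ fun x => ?_)
  simp only [ENNReal.toReal_ofReal (stdGaussianRadialDensity_nonneg _), Complex.real_smul]

theorem stdGaussian_absolutelyContinuous : stdGaussian E ≪ (volume : Measure E) := by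
  rw [stdGaussian_eq_withDensity]
  exact withDensity_absolutelyContinuous _ _

theorem integral_exp_neg_mul_sq_norm_stdGaussian {s : ℝ} (hs : 0 ≤ s) :
    ∫ x, Real.exp (-s * ‖x‖ ^ 2) ∂(stdGaussian E) = (1 + 2 * s) ^ (-(finrank ℝ E / 2 : ℝ)) := by
  have hm : Measurable fun x : E => ENNReal.ofReal (stdGaussianRadialDensity E ‖x‖) :=
    (continuous_stdGaussianRadialDensity.measurable.comp measurable_norm).ennreal_ofReal
  rw [stdGaussian_eq_withDensity, integral_withDensity_eq_integral_toReal_smul hm (by simp),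
    ← integral_stdGaussianRadialDensity_norm_mul_exp hs]
  simp only [ENNReal.toReal_ofReal (stdGaussianRadialDensity_nonneg _), smul_eq_mul]

theorem one_sub_le_exp_neg_sq {a : ℝ} (ha : 0 ≤ a) : 1 - a ≤ Real.exp (-a ^ 2) := by
  rcases le_total a 1 with h | h
  · nlinarith [Real.add_one_le_exp (-a ^ 2)]
  · linarith [Real.exp_pos (-a ^ 2)]

theorem one_sub_sqrt_mul_integral_norm_stdGaussian_le {s : ℝ} (hs : 0 ≤ s) :
    1 - √s * ∫ x, ‖x‖ ∂(stdGaussian E) ≤ (1 + 2 * s) ^ (-(finrank ℝ E / 2 : ℝ)) := by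
  have hlin : Integrable (fun x : E => √s * ‖x‖) (stdGaussian E) :=
    IsGaussian.integrable_id.norm.const_mul _
  have hexp : Integrable (fun x : E => Real.exp (-s * ‖x‖ ^ 2)) (stdGaussian E) :=
    .of_integral_ne_zero <| by
      rw [integral_exp_neg_mul_sq_norm_stdGaussian hs]; positivity
  calc 1 - √s * ∫ x, ‖x‖ ∂(stdGaussian E)
      = ∫ x, (1 - √s * ‖x‖) ∂(stdGaussian E) := by
        rw [integral_sub (integrable_const _) hlin, integral_const_mul, integral_const,
          probReal_univ, one_smul]
    _ ≤ ∫ x, Real.exp (-s * ‖x‖ ^ 2) ∂(stdGaussian E) := by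
        refine integral_mono ((integrable_const _).sub hlin) hexp fun x => ?_
        have h := one_sub_le_exp_neg_sq (show 0 ≤ √s * ‖x‖ by positivity)
        rwa [mul_pow, Real.sq_sqrt hs, ← neg_mul] at h
    _ = _ := integral_exp_neg_mul_sq_norm_stdGaussian hs

theorem nine_le_one_add_div_rpow {p : ℝ} (hp : 1 ≤ p) : 9 ≤ (1 + 8 / p) ^ p := by
  have h8 : 0 ≤ 8 / p := by positivity
  have h := one_add_mul_self_le_rpow_one_add (s := 8 / p) (by linarith) hp
  rw [mul_div_cancel₀ _ (by positivity)] at h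
  linarith

theorem sqrt_finrank_le_three_mul_integral_norm_stdGaussian [Nontrivial E] :
    √(finrank ℝ E : ℝ) ≤ 3 * ∫ x, ‖x‖ ∂(stdGaussian E) := by
  set N : ℝ := (finrank ℝ E : ℝ)
  have hN : 1 ≤ N := Nat.one_le_cast.2 finrank_pos
  have hrpow : (1 + 2 * (4 / N)) ^ (-(N / 2)) ≤ 1 / 3 := by
    calc (1 + 2 * (4 / N)) ^ (-(N / 2)) = 1 / √((1 + 8 / N) ^ N) := by
          rw [Real.sqrt_eq_rpow, ← Real.rpow_mul (by positivity), Real.rpow_neg (by positivity),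
            one_div]
          ring_nf
      _ ≤ 1 / √(3 ^ 2) := by
          gcongr
          linarith [nine_le_one_add_div_rpow hN]
      _ = 1 / 3 := by rw [Real.sqrt_sq (by norm_num)]
  have h := (one_sub_sqrt_mul_integral_norm_stdGaussian_le (E := E)
    (show 0 ≤ 4 / N by positivity)).trans hrpow
  rw [Real.sqrt_div (by norm_num), show (4 : ℝ) = 2 ^ 2 by norm_num, Real.sqrt_sq (by norm_num),
    div_mul_eq_mul_div, sub_le_comm, le_div_iff₀ (by positivity)] at h
  linarith

end GaussianDensity

section GaussianConcentration

open ContinuousLinearMap (rotation)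

variable {E : Type*} [NormedAddCommGroup E] [InnerProductSpace ℝ E]

theorem norm_rotation_snd_le (θ : ℝ) (z : E × E) : ‖(rotation θ z).2‖ ≤ ‖z.1‖ + ‖z.2‖ := by
  rw [ContinuousLinearMap.rotation_apply]
  refine (norm_add_le _ _).trans ?_
  rw [norm_smul, norm_smul, norm_neg]
  exact add_le_add (mul_le_of_le_one_left (norm_nonneg _) (Real.abs_sin_le_one _))
    (mul_le_of_le_one_left (norm_nonneg _) (Real.abs_cos_le_one _))

theorem hasDerivAt_rotation_fst (θ : ℝ) (z : E × E) :
    HasDerivAt (fun θ => (rotation θ z).1) (rotation θ z).2 θ := by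
  simp only [ContinuousLinearMap.rotation_apply]
  exact ((Real.hasDerivAt_cos θ).smul_const z.1).add ((Real.hasDerivAt_sin θ).smul_const z.2)

theorem lipschitzWith_rotation_fst (z : E × E) :
    LipschitzWith (‖z.1‖₊ + ‖z.2‖₊) fun θ => (rotation θ z).1 := by
  refine lipschitzWith_of_nnnorm_deriv_le
    (fun θ => (hasDerivAt_rotation_fst θ z).differentiableAt) fun θ => ?_
  rw [(hasDerivAt_rotation_fst θ z).deriv]
  exact norm_rotation_snd_le θ z

variable {F : E → ℝ} {K : ℝ≥0}

theorem abs_fderiv_rotation_le (hF : LipschitzWith K F) (θ : ℝ) (z : E × E) :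
    |fderiv ℝ F (rotation θ z).1 (rotation θ z).2| ≤ K * (‖z.1‖ + ‖z.2‖) := by
  refine ((fderiv ℝ F (rotation θ z).1).le_opNorm _).trans ?_
  have := norm_fderiv_le_of_lipschitz ℝ hF (x₀ := (rotation θ z).1)
  have := norm_rotation_snd_le θ z
  gcongr

theorem sub_eq_integral_fderiv_rotation (hF : LipschitzWith K F) {z : E × E}
    (hz : ∀ᵐ θ, DifferentiableAt ℝ F (rotation θ z).1) :
    F z.2 - F z.1 =
      ∫ θ in (0 : ℝ)..(Real.pi / 2), fderiv ℝ F (rotation θ z).1 (rotation θ z).2 := by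
  have hftc := ((hF.comp (lipschitzWith_rotation_fst z)).lipschitzOnWith
    (s := Set.uIcc 0 (Real.pi / 2))).absolutelyContinuousOnInterval.integral_deriv_eq_sub
  have hends : (F ∘ fun θ => (rotation θ z).1) (Real.pi / 2) - (F ∘ fun θ => (rotation θ z).1) 0 =
      F z.2 - F z.1 := by
    simp [ContinuousLinearMap.rotation_apply]
  rw [← hends, ← hftc]
  refine intervalIntegral.integral_congr_ae ?_
  filter_upwards [hz] with θ hθ _
  exact (hθ.hasFDerivAt.comp_hasDerivAt θ (hasDerivAt_rotation_fst θ z)).deriv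

/-- The uniform law on the angles `[0, π / 2]` of the rotations that carry one of two independent
Gaussian vectors to the other. -/
noncomputable def quarterTurnLaw : Measure ℝ :=
  volume[|Set.Ioc 0 (Real.pi / 2)]

instance isProbabilityMeasure_quarterTurnLaw : IsProbabilityMeasure quarterTurnLaw :=
  cond_isProbabilityMeasure_of_finite (by simp [Real.pi_pos]) (by simp)

theorem integral_quarterTurnLaw (D : ℝ → ℝ) :
    ∫ θ, Real.pi / 2 * D θ ∂quarterTurnLaw = ∫ θ in (0 : ℝ)..(Real.pi / 2), D θ := by
  have hpi : 0 < Real.pi / 2 := by positivity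
  rw [quarterTurnLaw, ProbabilityTheory.cond, integral_smul_measure, integral_const_mul,
    intervalIntegral.integral_of_le hpi.le, Real.volume_Ioc, sub_zero, ENNReal.toReal_inv,
    ENNReal.toReal_ofReal hpi.le, smul_eq_mul, inv_mul_cancel_left₀ hpi.ne']

variable [FiniteDimensional ℝ E] [MeasurableSpace E] [BorelSpace E]

theorem integrable_stdGaussian_of_lipschitzWith (hF : LipschitzWith K F) :
    Integrable F (stdGaussian E) := by
  have h : Integrable (fun x : E => |F 0| + K * ‖x‖) (stdGaussian E) :=
    (integrable_const _).add (IsGaussian.integrable_id.norm.const_mul _)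
  refine h.mono' hF.continuous.aestronglyMeasurable (ae_of_all _ fun x => ?_)
  have h0 := hF.norm_sub_le x 0
  rw [sub_zero] at h0
  exact (norm_le_norm_add_norm_sub' (F x) (F 0)).trans (by gcongr; rfl)

theorem measurable_fderiv_apply (F : E → ℝ) :
    Measurable fun p : E × E => fderiv ℝ F p.1 p.2 :=
  isBoundedBilinearMap_apply.continuous.measurable.comp
    (((measurable_fderiv ℝ F).comp measurable_fst).prodMk measurable_snd)

theorem measurable_rotation : Measurable fun p : (E × E) × ℝ => rotation p.2 p.1 := by
  simp only [ContinuousLinearMap.rotation_apply]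
  fun_prop

theorem integrable_fderiv_rotation (hF : LipschitzWith K F) (ρ : Measure ℝ) [IsFiniteMeasure ρ]
    (z : E × E) : Integrable (fun θ => fderiv ℝ F (rotation θ z).1 (rotation θ z).2) ρ := by
  have hrot : Measurable fun θ : ℝ => rotation θ z := by
    simp only [ContinuousLinearMap.rotation_apply]
    fun_prop
  have hm : Measurable fun θ : ℝ => fderiv ℝ F (rotation θ z).1 (rotation θ z).2 :=
    (measurable_fderiv_apply F).comp hrot
  exact .of_bound hm.aestronglyMeasurable _ (ae_of_all _ fun θ => abs_fderiv_rotation_le hF θ z)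

theorem measurePreserving_rotation (θ : ℝ) :
    MeasurePreserving (rotation θ) ((stdGaussian E).prod (stdGaussian E))
      ((stdGaussian E).prod (stdGaussian E)) :=
  ⟨by fun_prop, IsGaussian.map_rotation_eq_self integral_id_stdGaussian θ⟩

theorem lintegral_lintegral_rotation (ρ : Measure ℝ) [IsProbabilityMeasure ρ]
    {f : E × E → ℝ≥0∞} (hf : Measurable f) :
    ∫⁻ z, ∫⁻ θ, f (rotation θ z) ∂ρ ∂((stdGaussian E).prod (stdGaussian E)) =
      ∫⁻ z, f z ∂((stdGaussian E).prod (stdGaussian E)) := by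
  rw [lintegral_lintegral_swap (f := fun z θ => f (rotation θ z))
    (hf.comp measurable_rotation).aemeasurable]
  simp_rw [(measurePreserving_rotation _).lintegral_comp hf]
  rw [lintegral_const, measure_univ, mul_one]

theorem ae_ae_differentiableAt_rotation (hF : LipschitzWith K F) :
    ∀ᵐ z ∂((stdGaussian E).prod (stdGaussian E)), ∀ᵐ θ : ℝ,
      DifferentiableAt ℝ F (rotation θ z).1 := by
  have hmeas : MeasurableSet {x | DifferentiableAt ℝ F x} := measurableSet_of_differentiableAt ℝ F
  have hfst : ∀ᵐ z ∂((stdGaussian E).prod (stdGaussian E)), DifferentiableAt ℝ F z.1 :=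
    Measure.quasiMeasurePreserving_fst.ae
      (stdGaussian_absolutelyContinuous.ae_le hF.ae_differentiableAt)
  rw [Measure.ae_ae_comm]
  · exact ae_of_all _ fun θ => (measurePreserving_rotation θ).quasiMeasurePreserving.ae hfst
  · exact (measurable_fst.comp measurable_rotation) hmeas

theorem lintegral_exp_dual_stdGaussian (L : StrongDual ℝ E) :
    ∫⁻ y, ENNReal.ofReal (Real.exp (L y)) ∂(stdGaussian E) =
      ENNReal.ofReal (Real.exp (‖L‖ ^ 2 / 2)) := by
  have hmap : (stdGaussian E).map L = gaussianReal 0 (‖L‖ ^ 2).toNNReal := by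
    rw [IsGaussian.map_eq_gaussianReal L, integral_strongDual_stdGaussian,
      variance_dual_stdGaussian]
  have hmgf := mgf_gaussianReal hmap 1
  have hint : Integrable (fun y => Real.exp (1 * L y)) (stdGaussian E) :=
    (integrable_map_measure (f := L) (g := fun r => Real.exp (1 * r))
      (by fun_prop) (by fun_prop)).1 (hmap ▸ integrable_exp_mul_gaussianReal 1)
  simp only [mgf, one_mul] at hmgf hint
  rw [← ofReal_integral_eq_lintegral_ofReal hint (ae_of_all _ fun _ => (Real.exp_pos _).le), hmgf]
  simp

theorem lintegral_exp_fderiv_stdGaussian_le (hF : LipschitzWith K F) (a : ℝ) :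
    ∫⁻ z : E × E, ENNReal.ofReal (Real.exp (a * fderiv ℝ F z.1 z.2))
        ∂((stdGaussian E).prod (stdGaussian E)) ≤
      ENNReal.ofReal (Real.exp (a ^ 2 * K ^ 2 / 2)) := by
  have hm : Measurable fun p : E × E => ENNReal.ofReal (Real.exp (a * fderiv ℝ F p.1 p.2)) :=
    ((measurable_fderiv_apply F).const_mul _).exp.ennreal_ofReal
  rw [lintegral_prod _ hm.aemeasurable]
  refine (lintegral_mono fun x => ?_).trans_eq (by rw [lintegral_const, measure_univ, mul_one])
  refine (lintegral_exp_dual_stdGaussian (a • fderiv ℝ F x)).trans_le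
    (ENNReal.ofReal_le_ofReal (Real.exp_le_exp.2 ?_))
  rw [norm_smul, Real.norm_eq_abs, mul_pow, sq_abs]
  have := norm_fderiv_le_of_lipschitz ℝ hF (x₀ := x)
  gcongr

/-- Along the rotations `θ ↦ cos θ • z.1 + sin θ • z.2` the increment of `F` is the mean of
`(π / 2) ⟪∇F, ·⟫` at a pair of vectors which, for every `θ`, is again a pair of independent standard
Gaussian vectors; Jensen's inequality moves the exponential inside the mean. -/
theorem lintegral_exp_sub_stdGaussian_le (hF : LipschitzWith K F) :
    ∫⁻ z, ENNReal.ofReal (Real.exp (F z.2 - F z.1)) ∂((stdGaussian E).prod (stdGaussian E)) ≤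
      ENNReal.ofReal (Real.exp ((Real.pi / 2) ^ 2 * K ^ 2 / 2)) := by
  have hm : Measurable fun z : E × E =>
      ENNReal.ofReal (Real.exp (Real.pi / 2 * fderiv ℝ F z.1 z.2)) :=
    ((measurable_fderiv_apply F).const_mul _).exp.ennreal_ofReal
  refine le_trans ?_ (lintegral_exp_fderiv_stdGaussian_le hF (Real.pi / 2))
  rw [← lintegral_lintegral_rotation quarterTurnLaw hm]
  refine lintegral_mono_ae ?_
  filter_upwards [ae_ae_differentiableAt_rotation hF] with z hz
  rw [sub_eq_integral_fderiv_rotation hF hz, ← integral_quarterTurnLaw]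
  exact ofReal_exp_integral_le_lintegral_exp
    ((integrable_fderiv_rotation hF quarterTurnLaw z).const_mul _)

theorem lintegral_exp_sub_integral_stdGaussian_le (hF : LipschitzWith K F) :
    ∫⁻ x, ENNReal.ofReal (Real.exp (F x - ∫ y, F y ∂(stdGaussian E))) ∂(stdGaussian E) ≤
      ENNReal.ofReal (Real.exp ((Real.pi / 2) ^ 2 * K ^ 2 / 2)) := by
  have hi := integrable_stdGaussian_of_lipschitzWith hF
  have hm : Measurable F := hF.continuous.measurable
  refine le_trans ?_ (lintegral_exp_sub_stdGaussian_le hF)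
  rw [lintegral_prod_symm _ (by fun_prop)]
  refine lintegral_mono fun x => ?_
  have h := ofReal_exp_integral_le_lintegral_exp (X := fun y => F x - F y)
    ((integrable_const (F x)).sub hi)
  rwa [integral_sub (integrable_const _) hi, integral_const, probReal_univ, one_smul] at h

theorem hasSubgaussianMGF_stdGaussian_of_lipschitzWith (hF : LipschitzWith K F) :
    HasSubgaussianMGF (fun x => F x - ∫ y, F y ∂(stdGaussian E)) ((2 * K) ^ 2)
      (stdGaussian E) := by
  have hm : Measurable F := hF.continuous.measurable
  refine hasSubgaussianMGF_of_lintegral_exp_le (by fun_prop) fun t => ?_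
  have htF : LipschitzWith (‖t‖₊ * K) fun x => t * F x := (lipschitzWith_smul t).comp hF
  have h := lintegral_exp_sub_integral_stdGaussian_le htF
  simp_rw [integral_const_mul, ← mul_sub] at h
  refine h.trans (ENNReal.ofReal_le_ofReal (Real.exp_le_exp.2 ?_))
  have hpi : Real.pi / 2 ≤ 2 := by linarith [Real.pi_le_four]
  calc (Real.pi / 2) ^ 2 * (‖t‖₊ * K : ℝ≥0) ^ 2 / 2 ≤ 2 ^ 2 * (‖t‖₊ * K : ℝ≥0) ^ 2 / 2 := by
        gcongr
    _ = ((2 * K) ^ 2 : ℝ≥0) * t ^ 2 / 2 := by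
        push_cast
        rw [Real.norm_eq_abs, mul_pow, sq_abs]
        ring

end GaussianConcentration

section HomogeneousExtension

variable {E : Type*} [NormedAddCommGroup E] [NormedSpace ℝ E]

theorem norm_normalize_le_one (x : E) : ‖‖x‖⁻¹ • x‖ ≤ 1 := by
  rw [norm_smul, norm_inv, norm_norm]
  exact inv_mul_le_one

theorem norm_mul_norm_normalize_sub_le (x : E) {y : E} (hy : y ≠ 0) :
    ‖x‖ * ‖‖x‖⁻¹ • x - ‖y‖⁻¹ • y‖ ≤ 2 * ‖x - y‖ := by
  have hy' : ‖y‖ ≠ 0 := norm_ne_zero_iff.2 hy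
  rcases eq_or_ne x 0 with rfl | hx
  · simp
  have hx' : ‖x‖ ≠ 0 := norm_ne_zero_iff.2 hx
  have e : ‖x‖ • (‖x‖⁻¹ • x - ‖y‖⁻¹ • y) = (x - y) + (‖y‖ - ‖x‖) • (‖y‖⁻¹ • y) := by
    rw [smul_sub, smul_inv_smul₀ hx', sub_smul, smul_inv_smul₀ hy']
    abel
  calc ‖x‖ * ‖‖x‖⁻¹ • x - ‖y‖⁻¹ • y‖ = ‖‖x‖ • (‖x‖⁻¹ • x - ‖y‖⁻¹ • y)‖ := by
        rw [norm_smul, norm_norm]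
    _ ≤ ‖x - y‖ + ‖(‖y‖ - ‖x‖) • (‖y‖⁻¹ • y)‖ := by rw [e]; exact norm_add_le _ _
    _ = ‖x - y‖ + |‖y‖ - ‖x‖| := by
        rw [norm_smul, norm_smul, norm_inv, norm_norm, inv_mul_cancel₀ hy', mul_one,
          Real.norm_eq_abs]
    _ ≤ 2 * ‖x - y‖ := by
        rw [abs_sub_comm]
        linarith [abs_norm_sub_norm_le x y]

theorem lipschitzWith_norm_mul_comp_normalize {f : E → ℝ} {K M : ℝ≥0} (hf : LipschitzWith K f)
    (hM : ∀ u, ‖u‖ ≤ 1 → |f u| ≤ M) :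
    LipschitzWith (2 * K + M) fun x => ‖x‖ * f (‖x‖⁻¹ • x) := by
  have hM' : ∀ x, |f (‖x‖⁻¹ • x)| ≤ M := fun x => hM _ (norm_normalize_le_one x)
  refine LipschitzWith.of_le_add_mul _ fun x y => ?_
  rw [dist_eq_norm]
  push_cast
  rcases eq_or_ne y 0 with rfl | hy
  · simp only [norm_zero, zero_mul, sub_zero, zero_add]
    rw [mul_comm]
    gcongr
    exact ((le_abs_self _).trans (hM' x)).trans (le_add_of_nonneg_left (by positivity))
  have hdir : ‖x‖ * (f (‖x‖⁻¹ • x) - f (‖y‖⁻¹ • y)) ≤ K * (2 * ‖x - y‖) := by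
    calc ‖x‖ * (f (‖x‖⁻¹ • x) - f (‖y‖⁻¹ • y))
        ≤ ‖x‖ * (K * ‖‖x‖⁻¹ • x - ‖y‖⁻¹ • y‖) := by
          gcongr
          exact (le_abs_self _).trans (hf.norm_sub_le _ _)
      _ = K * (‖x‖ * ‖‖x‖⁻¹ • x - ‖y‖⁻¹ • y‖) := by ring
      _ ≤ K * (2 * ‖x - y‖) :=
        mul_le_mul_of_nonneg_left (norm_mul_norm_normalize_sub_le x hy) K.2
  have hrad : (‖x‖ - ‖y‖) * f (‖y‖⁻¹ • y) ≤ ‖x - y‖ * M := by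
    refine (le_abs_self _).trans ?_
    rw [abs_mul]
    exact mul_le_mul (abs_norm_sub_norm_le x y) (hM' y) (abs_nonneg _) (norm_nonneg _)
  linarith

end HomogeneousExtension

section SphereConcentration

variable {E : Type*} [NormedAddCommGroup E] [InnerProductSpace ℝ E] [FiniteDimensional ℝ E]
  [MeasurableSpace E] [BorelSpace E]

variable (E) in
/-- The uniform probability measure on the unit sphere, as a measure on the ambient space. -/
noncomputable def unitSphereLaw : Measure E :=
  (((volume : Measure E).toSphere Set.univ)⁻¹ • (volume : Measure E).toSphere).map Subtype.val

theorem ae_unitSphereLaw_norm_eq_one : ∀ᵐ x ∂(unitSphereLaw E), ‖x‖ = 1 := by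
  rw [unitSphereLaw, ae_map_iff measurable_subtype_coe.aemeasurable
    (measurableSet_eq_fun measurable_norm measurable_const)]
  exact ae_of_all _ fun x => by simp

theorem lintegral_normalize_mul_norm [Nontrivial E] {f : E → ℝ≥0∞} {g : ℝ → ℝ≥0∞}
    (hf : Measurable f) (hg : Measurable g) :
    ∫⁻ x, f (‖x‖⁻¹ • x) * g ‖x‖ ∂(volume : Measure E) =
      (∫⁻ u, f u ∂(volume : Measure E).toSphere) *
        ∫⁻ r, g r ∂(Measure.volumeIoiPow (finrank ℝ E - 1)) := by
  have hmp := (volume : Measure E).measurePreserving_homeomorphUnitSphereProd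
  rw [← lintegral_prod_mul (by fun_prop) (by fun_prop), ← hmp.map_eq,
    lintegral_map (by fun_prop) (Homeomorph.measurable _)]
  conv_lhs => rw [← restrict_compl_singleton (μ := (volume : Measure E)) 0,
    ← lintegral_subtype_comap (measurableSet_singleton _).compl]
  refine lintegral_congr fun x => ?_
  simp only [homeomorphUnitSphereProd_apply_fst_coe, homeomorphUnitSphereProd_apply_snd_coe]

variable [Nontrivial E]

theorem toSphere_univ_ne_zero : (volume : Measure E).toSphere Set.univ ≠ 0 := by
  rw [Ne, Measure.measure_univ_eq_zero]
  exact Measure.toSphere_ne_zero _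

instance isProbabilityMeasure_unitSphereLaw : IsProbabilityMeasure (unitSphereLaw E) := by
  refine ⟨?_⟩
  rw [unitSphereLaw, Measure.map_apply measurable_subtype_coe .univ]
  exact ENNReal.inv_mul_cancel toSphere_univ_ne_zero (measure_ne_top _ _)

theorem toSphere_preimage_val (s : Set E) (hs : MeasurableSet s) :
    (volume : Measure E).toSphere (Subtype.val ⁻¹' s) =
      (volume : Measure E).toSphere Set.univ * unitSphereLaw E s := by
  rw [unitSphereLaw, Measure.map_apply measurable_subtype_coe hs, Measure.smul_apply, smul_eq_mul,
    ENNReal.mul_inv_cancel_left toSphere_univ_ne_zero (measure_ne_top _ _)]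

theorem withDensity_norm_apply_normalize_norm {g : ℝ → ℝ≥0∞} (hg : Measurable g) {s : Set E}
    (hs : MeasurableSet s) {t : Set ℝ} (ht : MeasurableSet t) :
    (volume : Measure E).withDensity (fun x => g ‖x‖) {x | ‖x‖⁻¹ • x ∈ s ∧ ‖x‖ ∈ t} =
      (volume : Measure E).toSphere (Subtype.val ⁻¹' s) *
        ∫⁻ r, t.indicator g r ∂(Measure.volumeIoiPow (finrank ℝ E - 1)) := by
  have hm : Measurable fun x : E => ‖x‖⁻¹ • x := by fun_prop
  have hst : MeasurableSet {x : E | ‖x‖⁻¹ • x ∈ s ∧ ‖x‖ ∈ t} := (hm hs).inter (measurable_norm ht)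
  have hind : ∀ x : E, {x | ‖x‖⁻¹ • x ∈ s ∧ ‖x‖ ∈ t}.indicator (fun x => g ‖x‖) x =
      s.indicator 1 (‖x‖⁻¹ • x) * t.indicator g ‖x‖ := by
    intro x
    by_cases h1 : ‖x‖⁻¹ • x ∈ s <;> by_cases h2 : ‖x‖ ∈ t <;> simp [h1, h2]
  rw [withDensity_apply _ hst, ← lintegral_indicator hst, lintegral_congr hind,
    lintegral_normalize_mul_norm (measurable_one.indicator hs) (hg.indicator ht)]
  congr 1
  rw [← lintegral_indicator_one (measurable_subtype_coe hs)]
  rfl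

theorem map_normalize_norm_withDensity_norm {g : ℝ → ℝ≥0∞} (hg : Measurable g)
    [IsFiniteMeasure ((volume : Measure E).withDensity fun x => g ‖x‖)] :
    ((volume : Measure E).withDensity fun x => g ‖x‖).map (fun x => (‖x‖⁻¹ • x, ‖x‖)) =
      (unitSphereLaw E).prod (((volume : Measure E).withDensity fun x => g ‖x‖).map norm) := by
  refine (Measure.prod_eq fun s t hs ht => ?_).symm
  have hm : Measurable (fun x : E => (‖x‖⁻¹ • x, ‖x‖)) := by fun_prop
  have hnorm : (volume : Measure E).withDensity (fun x => g ‖x‖) (norm ⁻¹' t) =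
      (volume : Measure E).toSphere Set.univ *
        ∫⁻ r, t.indicator g r ∂(Measure.volumeIoiPow (finrank ℝ E - 1)) := by
    have h := withDensity_norm_apply_normalize_norm (E := E) hg .univ ht
    simp only [Set.mem_univ, true_and, Set.preimage_univ] at h
    exact h
  rw [Measure.map_apply hm (hs.prod ht), Measure.map_apply measurable_norm ht, hnorm, ← mul_assoc,
    mul_comm (unitSphereLaw E s), ← toSphere_preimage_val s hs]
  exact withDensity_norm_apply_normalize_norm hg hs ht

theorem map_normalize_norm_stdGaussian :
    (stdGaussian E).map (fun x => (‖x‖⁻¹ • x, ‖x‖)) =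
      (unitSphereLaw E).prod ((stdGaussian E).map norm) := by
  have := isFiniteMeasure_withDensity_ofReal
    (integrable_stdGaussianRadialDensity_norm (E := E)).2
  have h := map_normalize_norm_withDensity_norm (E := E)
    (g := fun r => ENNReal.ofReal (stdGaussianRadialDensity E r))
    continuous_stdGaussianRadialDensity.measurable.ennreal_ofReal
  rwa [← stdGaussian_eq_withDensity] at h

theorem integral_norm_mul_comp_normalize_stdGaussian {f : E → ℝ} (hf : Measurable f) :
    ∫ x, ‖x‖ * f (‖x‖⁻¹ • x) ∂(stdGaussian E) =
      (∫ x, ‖x‖ ∂(stdGaussian E)) * ∫ u, f u ∂(unitSphereLaw E) := by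
  have hm : Measurable (fun x : E => (‖x‖⁻¹ • x, ‖x‖)) := by fun_prop
  have hpolar : ∫ p, f p.1 * p.2 ∂((stdGaussian E).map (fun x => (‖x‖⁻¹ • x, ‖x‖))) =
      ∫ x, ‖x‖ * f (‖x‖⁻¹ • x) ∂(stdGaussian E) := by
    rw [integral_map hm.aemeasurable (by fun_prop)]
    simp only [mul_comm]
  rw [← hpolar, map_normalize_norm_stdGaussian, integral_prod_mul f (fun r => r),
    integral_map measurable_norm.aemeasurable (by fun_prop), mul_comm]

/-- In polar coordinates the radius is independent of the direction, so Jensen's inequality allows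
replacing it by its mean. -/
theorem lintegral_exp_mul_unitSphereLaw_le {f : E → ℝ} (hf : Measurable f) (s : ℝ) :
    ∫⁻ u, ENNReal.ofReal (Real.exp (s * ((∫ x, ‖x‖ ∂(stdGaussian E)) * f u))) ∂(unitSphereLaw E) ≤
      ∫⁻ x, ENNReal.ofReal (Real.exp (s * (‖x‖ * f (‖x‖⁻¹ • x)))) ∂(stdGaussian E) := by
  have : IsProbabilityMeasure ((stdGaussian E).map norm) :=
    Measure.isProbabilityMeasure_map measurable_norm.aemeasurable
  have hpolar : ∫⁻ x, ENNReal.ofReal (Real.exp (s * (‖x‖ * f (‖x‖⁻¹ • x)))) ∂(stdGaussian E) =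
      ∫⁻ u, ∫⁻ r, ENNReal.ofReal (Real.exp (s * (r * f u))) ∂((stdGaussian E).map norm)
        ∂(unitSphereLaw E) := by
    rw [← lintegral_prod (fun p : E × ℝ => ENNReal.ofReal (Real.exp (s * (p.2 * f p.1))))
      (by fun_prop), ← map_normalize_norm_stdGaussian, lintegral_map (by fun_prop) (by fun_prop)]
  rw [hpolar]
  refine lintegral_mono fun u => ?_
  have hr : Integrable (fun r : ℝ => r) ((stdGaussian E).map norm) :=
    (integrable_map_measure (by fun_prop) measurable_norm.aemeasurable).2
      IsGaussian.integrable_id.norm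
  have h := ofReal_exp_integral_le_lintegral_exp ((hr.mul_const (f u)).const_mul s)
  rwa [integral_const_mul, integral_mul_const,
    integral_map measurable_norm.aemeasurable (by fun_prop)] at h

variable {F : E → ℝ} {K : ℝ≥0}

theorem integrable_unitSphereLaw_of_lipschitzWith (hF : LipschitzWith K F) :
    Integrable F (unitSphereLaw E) := by
  refine .of_bound hF.continuous.aestronglyMeasurable (‖F 0‖ + K) ?_
  filter_upwards [ae_unitSphereLaw_norm_eq_one (E := E)] with x hx
  have h0 := hF.norm_sub_le x 0
  rw [sub_zero, hx, mul_one] at h0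
  exact (norm_le_norm_add_norm_sub' (F x) (F 0)).trans (by gcongr)

theorem abs_sub_integral_unitSphereLaw_le (hF : LipschitzWith K F) {u : E} (hu : ‖u‖ ≤ 1) :
    |F u - ∫ v, F v ∂(unitSphereLaw E)| ≤ 2 * K := by
  have e : F u - ∫ v, F v ∂(unitSphereLaw E) = ∫ v, (F u - F v) ∂(unitSphereLaw E) := by
    rw [integral_sub (integrable_const _) (integrable_unitSphereLaw_of_lipschitzWith hF),
      integral_const, probReal_univ, one_smul]
  rw [e, ← Real.norm_eq_abs]
  refine (norm_integral_le_of_norm_le_const (C := 2 * K) ?_).trans (by simp)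
  filter_upwards [ae_unitSphereLaw_norm_eq_one (E := E)] with v hv
  refine (hF.norm_sub_le u v).trans ?_
  rw [mul_comm]
  gcongr
  linarith [norm_sub_le u v]

/-- **Lévy's concentration inequality on the sphere**, obtained by applying Gaussian concentration
to the positively homogeneous extension of `F - 𝔼 F`. -/
theorem hasSubgaussianMGF_unitSphereLaw_of_lipschitzWith (hF : LipschitzWith K F) :
    HasSubgaussianMGF (fun x => F x - ∫ v, F v ∂(unitSphereLaw E))
      ((24 * K) ^ 2 / finrank ℝ E) (unitSphereLaw E) := by
  set f : E → ℝ := fun u => F u - ∫ v, F v ∂(unitSphereLaw E) with hf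
  set R := ∫ x, ‖x‖ ∂(stdGaussian E)
  have hfm : Measurable f := hF.continuous.measurable.sub_const _
  have hfl : LipschitzWith K f := (hF.sub (LipschitzWith.const _)).weaken (by simp)
  have hG := hasSubgaussianMGF_stdGaussian_of_lipschitzWith
    (lipschitzWith_norm_mul_comp_normalize (M := 2 * K) hfl
      fun u hu => abs_sub_integral_unitSphereLaw_le hF hu)
  have hmean : ∫ u, f u ∂(unitSphereLaw E) = 0 := by
    rw [hf, integral_sub (integrable_unitSphereLaw_of_lipschitzWith hF) (integrable_const _),
      integral_const, probReal_univ, one_smul, sub_self]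
  simp_rw [integral_norm_mul_comp_normalize_stdGaussian hfm, hmean, mul_zero, sub_zero] at hG
  have hN : (0 : ℝ) < finrank ℝ E := Nat.cast_pos.2 finrank_pos
  have hR : √(finrank ℝ E : ℝ) ≤ 3 * R := sqrt_finrank_le_three_mul_integral_norm_stdGaussian
  have hR0 : 0 < R := by linarith [Real.sqrt_pos.2 hN]
  refine hasSubgaussianMGF_of_lintegral_exp_le hfm.aemeasurable fun t => ?_
  have h : ∫⁻ u, ENNReal.ofReal (Real.exp (t / R * (R * f u))) ∂(unitSphereLaw E) ≤ _ :=
    (lintegral_exp_mul_unitSphereLaw_le hfm (t / R)).trans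
      (lintegral_exp_mul_le_of_hasSubgaussianMGF hG (t / R))
  simp_rw [← mul_assoc, div_mul_cancel₀ t hR0.ne'] at h
  refine h.trans (ENNReal.ofReal_le_ofReal (Real.exp_le_exp.2 ?_))
  have hNR : (finrank ℝ E : ℝ) ≤ 9 * R ^ 2 := by
    have := Real.sqrt_le_left (x := (finrank ℝ E : ℝ)) (y := 3 * R) (by positivity) |>.1 hR
    linarith
  have hc : (((2 * (2 * K + 2 * K)) ^ 2 : ℝ≥0) : ℝ) = (24 * K) ^ 2 / 9 := by push_cast; ring
  rw [hc]
  push_cast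
  calc (24 * K : ℝ) ^ 2 / 9 * (t / R) ^ 2 / 2 = (24 * K : ℝ) ^ 2 / (9 * R ^ 2) * t ^ 2 / 2 := by
        field_simp
    _ ≤ (24 * K : ℝ) ^ 2 / finrank ℝ E * t ^ 2 / 2 := by gcongr

end SphereConcentration

section SpectralCoupling

variable {ι 𝕜 E : Type*} [Fintype ι] [RCLike 𝕜] [NormedAddCommGroup E] [InnerProductSpace 𝕜 E]

theorem norm_sq_inner_orthonormalBasis_mem_doublyStochastic [DecidableEq ι]
    (u v : OrthonormalBasis ι 𝕜 E) :
    Matrix.of (fun i j => ‖inner 𝕜 (u i) (v j)‖ ^ 2) ∈ doublyStochastic ℝ ι := by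
  refine mem_doublyStochastic_iff_sum.2 ⟨fun i j => sq_nonneg _, fun i => ?_, fun j => ?_⟩
  · simp only [Matrix.of_apply, v.sum_sq_norm_inner_left, u.norm_eq_one, one_pow]
  · simp only [Matrix.of_apply, u.sum_sq_norm_inner_right, v.norm_eq_one, one_pow]

/-- The squared Hilbert–Schmidt distance of two symmetric operators is the cost of transporting one
spectrum to the other along the squared overlaps of the eigenvectors. -/
theorem sum_norm_sq_inner_mul_sq_sub_eq_re_trace {κ : Type*} [Fintype κ] {T S : E →ₗ[𝕜] E}
    (hT : T.IsSymmetric) (hS : S.IsSymmetric) (u : OrthonormalBasis ι 𝕜 E)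
    (v : OrthonormalBasis κ 𝕜 E) {a : ι → ℝ} {b : κ → ℝ} (hu : ∀ i, T (u i) = (a i : 𝕜) • u i)
    (hv : ∀ j, S (v j) = (b j : 𝕜) • v j) :
    ∑ i, ∑ j, ‖inner 𝕜 (u i) (v j)‖ ^ 2 * (a i - b j) ^ 2 =
      RCLike.re (LinearMap.trace 𝕜 E ((T - S) ∘ₗ (T - S))) := by
  have hentry : ∀ i j, inner 𝕜 ((T - S) (u i)) (v j) =
      ((a i - b j : ℝ) : 𝕜) * inner 𝕜 (u i) (v j) := by
    intro i j
    rw [LinearMap.sub_apply, inner_sub_left, hS, hu, hv, inner_smul_left, inner_smul_right,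
      RCLike.conj_ofReal, RCLike.ofReal_sub, sub_mul]
  rw [LinearMap.trace_eq_sum_inner _ u, map_sum]
  refine Finset.sum_congr rfl fun i _ => ?_
  rw [LinearMap.comp_apply, ← (hT.sub hS) (u i), inner_self_eq_norm_sq,
    ← v.sum_sq_norm_inner_left]
  refine Finset.sum_congr rfl fun j _ => ?_
  rw [hentry, norm_mul, mul_pow, RCLike.norm_ofReal, sq_abs, mul_comm]

variable {α : Type*} [PseudoMetricSpace α] {f : α → ℝ} {K : ℝ≥0} {P : Matrix ι ι ℝ}
  [DecidableEq ι]

theorem abs_sum_sub_sum_le_of_mem_doublyStochastic (hP : P ∈ doublyStochastic ℝ ι)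
    (hf : LipschitzWith K f) (a b : ι → α) :
    |∑ i, f (a i) - ∑ j, f (b j)| ≤ K * ∑ i, ∑ j, P i j * dist (a i) (b j) := by
  obtain ⟨hP0, hrow, hcol⟩ := mem_doublyStochastic_iff_sum.1 hP
  have ha : ∑ i, f (a i) = ∑ i, ∑ j, P i j * f (a i) := by
    simp only [← Finset.sum_mul, hrow, one_mul]
  have hb : ∑ j, f (b j) = ∑ i, ∑ j, P i j * f (b j) := by
    rw [Finset.sum_comm]
    simp only [← Finset.sum_mul, hcol, one_mul]
  rw [ha, hb]
  simp only [← Finset.sum_sub_distrib, ← mul_sub, Finset.mul_sum]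
  refine (Finset.abs_sum_le_sum_abs _ _).trans (Finset.sum_le_sum fun i _ => ?_)
  refine (Finset.abs_sum_le_sum_abs _ _).trans (Finset.sum_le_sum fun j _ => ?_)
  rw [abs_mul, abs_of_nonneg (hP0 i j), mul_left_comm, ← Real.dist_eq]
  exact mul_le_mul_of_nonneg_left (hf.dist_le_mul _ _) (hP0 i j)

theorem sum_mul_le_sqrt_of_mem_doublyStochastic (hP : P ∈ doublyStochastic ℝ ι) (c : ι → ι → ℝ) :
    ∑ i, ∑ j, P i j * c i j ≤ √(Fintype.card ι * ∑ i, ∑ j, P i j * c i j ^ 2) := by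
  obtain ⟨hP0, hrow, -⟩ := mem_doublyStochastic_iff_sum.1 hP
  have hmass : ∑ q : ι × ι, P q.1 q.2 = Fintype.card ι := by
    simp [Fintype.sum_prod_type, hrow]
  simp only [← Fintype.sum_prod_type', ← hmass]
  refine Real.le_sqrt_of_sq_le (Finset.sum_sq_le_sum_mul_sum_of_sq_le_mul _
    (fun q _ => hP0 _ _) (fun q _ => mul_nonneg (hP0 _ _) (sq_nonneg _)) fun q _ => ?_)
  rw [mul_pow, sq (P q.1 q.2), mul_assoc]

end SpectralCoupling

namespace SpinChain

section SpectralStability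

variable {ι : Type} [Fintype ι] [DecidableEq ι] {A B : Matrix ι ι ℂ} {f : ℝ → ℝ} {K : ℝ≥0}

theorem toEuclideanLin_eigenvectorBasis (hA : A.IsHermitian) (i : ι) :
    A.toEuclideanLin (hA.eigenvectorBasis i) =
      (hA.eigenvalues i : ℂ) • hA.eigenvectorBasis i :=
  congrArg (WithLp.toLp 2) (hA.mulVec_eigenvectorBasis i)

theorem trace_toEuclideanLin_comp (A B : Matrix ι ι ℂ) :
    LinearMap.trace ℂ (EuclideanSpace ℂ ι) (A.toEuclideanLin ∘ₗ B.toEuclideanLin) =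
      (A * B).trace := by
  rw [Matrix.toEuclideanLin_eq_toLin_orthonormal, ← Matrix.toLin_mul, Matrix.trace_toLin_eq]

theorem abs_sum_eigenvalues_sub_le (hA : A.IsHermitian) (hB : B.IsHermitian)
    (hf : LipschitzWith K f) :
    |∑ i, f (hA.eigenvalues i) - ∑ i, f (hB.eigenvalues i)| ≤
      K * √(Fintype.card ι * ((A - B) * (A - B)).trace.re) := by
  have hcost := sum_norm_sq_inner_mul_sq_sub_eq_re_trace (a := hA.eigenvalues)
    (b := hB.eigenvalues)
    (Matrix.isSymmetric_toEuclideanLin_iff.2 hA) (Matrix.isSymmetric_toEuclideanLin_iff.2 hB)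
    hA.eigenvectorBasis hB.eigenvectorBasis (toEuclideanLin_eigenvectorBasis hA)
    (toEuclideanLin_eigenvectorBasis hB)
  rw [← map_sub, trace_toEuclideanLin_comp] at hcost
  have hP := norm_sq_inner_orthonormalBasis_mem_doublyStochastic
    hA.eigenvectorBasis hB.eigenvectorBasis
  refine (abs_sum_sub_sum_le_of_mem_doublyStochastic hP hf _ _).trans
    (mul_le_mul_of_nonneg_left ?_ K.2)
  refine (sum_mul_le_sqrt_of_mem_doublyStochastic hP _).trans_eq ?_
  simp only [Real.dist_eq, sq_abs, Matrix.of_apply]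
  rw [hcost]
  rfl

theorem integral_spectralMeasure (hA : A.IsHermitian) (f : ℝ → ℝ) :
    ∫ y, f y ∂(spectralMeasure hA) = (Fintype.card ι : ℝ)⁻¹ * ∑ i, f (hA.eigenvalues i) := by
  rw [spectralMeasure, integral_smul_measure,
    integral_finsetSum_measure fun i _ => integrable_dirac (by simp)]
  simp

theorem integral_sq_spectralMeasure (hA : A.IsHermitian) :
    ∫ y, y ^ 2 ∂(spectralMeasure hA) = (A * A).trace.re / Fintype.card ι := by
  have h := sum_eval_eigenvalues hA (Polynomial.X ^ 2)
  simp only [Polynomial.eval_pow, Polynomial.eval_X, Polynomial.map_pow, Polynomial.map_X,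
    map_pow, Polynomial.aeval_X] at h
  rw [integral_spectralMeasure, h, sq, inv_mul_eq_div]

theorem integrable_spectralMeasure [Nonempty ι] (hA : A.IsHermitian) (f : ℝ → ℝ) :
    Integrable f (spectralMeasure hA) := by
  rw [spectralMeasure]
  refine Integrable.smul_measure ?_ (by simp)
  exact integrable_finsetSum_measure.2 fun i _ => integrable_dirac (by simp)

theorem abs_integral_spectralMeasure_sub_le (hA : A.IsHermitian) (hB : B.IsHermitian)
    (hf : LipschitzWith K f) :
    |∫ y, f y ∂(spectralMeasure hA) - ∫ y, f y ∂(spectralMeasure hB)| ≤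
      K * √(((A - B) * (A - B)).trace.re / Fintype.card ι) := by
  set N : ℝ := (Fintype.card ι : ℝ)
  set d := ((A - B) * (A - B)).trace.re
  have hN0 : 0 ≤ N := Nat.cast_nonneg _
  have hscale : N⁻¹ * √(N * d) = √(d / N) := by
    rw [Real.sqrt_mul hN0, Real.sqrt_div' _ hN0, ← mul_assoc, ← div_eq_inv_mul,
      Real.sqrt_div_self, inv_mul_eq_div]
  rw [integral_spectralMeasure, integral_spectralMeasure, ← mul_sub, abs_mul,
    abs_of_nonneg (inv_nonneg.2 hN0), ← hscale, mul_left_comm]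
  exact mul_le_mul_of_nonneg_left (abs_sum_eigenvalues_sub_le hA hB hf) (inv_nonneg.2 hN0)

end SpectralStability

end SpinChain

theorem sum_sum_ite_mul_le_of_card_fiber_le {α β : Type*} [Fintype α] [DecidableEq β] (w : α → β)
    {d : ℕ} (hd : ∀ p, (Finset.univ.filter fun q => w p = w q).card ≤ d) (x : α → ℝ) :
    ∑ p, ∑ q, (if w p = w q then x p * x q else 0) ≤ d * ∑ p, x p ^ 2 := by
  have hswap : ∑ p, ∑ q, (if w p = w q then x q ^ 2 else 0) =
      ∑ p, ∑ q, if w p = w q then x p ^ 2 else 0 := by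
    rw [Finset.sum_comm]
    simp only [eq_comm]
  have hdiag : ∑ p, ∑ q, (if w p = w q then x p ^ 2 else 0) ≤ d * ∑ p, x p ^ 2 := by
    rw [Finset.mul_sum]
    refine Finset.sum_le_sum fun p _ => ?_
    rw [← Finset.sum_filter, Finset.sum_const, nsmul_eq_mul]
    exact mul_le_mul_of_nonneg_right (Nat.cast_le.2 (hd p)) (sq_nonneg _)
  calc ∑ p, ∑ q, (if w p = w q then x p * x q else 0)
      ≤ ∑ p, ∑ q, ((if w p = w q then x p ^ 2 else 0) / 2 +
          (if w p = w q then x q ^ 2 else 0) / 2) := by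
        gcongr with p _ q _
        split_ifs
        · linarith [two_mul_le_add_sq (x p) (x q)]
        · simp
    _ = ∑ p, ∑ q, if w p = w q then x p ^ 2 else 0 := by
        simp only [Finset.sum_add_distrib, ← Finset.sum_div, hswap, add_halves]
    _ ≤ d * ∑ p, x p ^ 2 := hdiag

namespace SpinChain

section PauliStrings

variable {n : ℕ}

/-- The basis `I, σ⁽¹⁾, σ⁽²⁾, σ⁽³⁾` of the `2 × 2` matrices, with `none` standing for the
identity. -/
def pauliBasis (c : Option (Fin 3)) : Matrix (Fin 2) (Fin 2) ℂ :=
  c.elim 1 pauli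

/-- The tensor product of the matrices `pauliBasis (w k)`. These products are orthogonal for the
Hilbert–Schmidt inner product, and the terms of the Hamiltonian are among them. -/
def pauliString (w : Fin n → Option (Fin 3)) : Matrix (Fin n → Fin 2) (Fin n → Fin 2) ℂ :=
  tensor fun k => pauliBasis (w k)

/-- The word of the Pauli string `σ⁽ᵃ⁾_j σ⁽ᵇ⁾_{j+1}`, where `p = (a, b, j)`. -/
def bondWord (p : Fin 3 × Fin 3 × Fin n) : Fin n → Option (Fin 3) :=
  Function.update (Function.update (fun _ => none) p.2.2 (some p.1)) (finRotate n p.2.2)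
    (some p.2.1)

theorem trace_tensor (M : Fin n → Matrix (Fin 2) (Fin 2) ℂ) :
    (tensor M).trace = ∏ k, (M k).trace := by
  simp only [Matrix.trace, Matrix.diag_apply, tensor, Matrix.of_apply]
  exact (Fintype.prod_sum fun k i => M k i i).symm

theorem trace_pauliBasis_mul (c d : Option (Fin 3)) :
    (pauliBasis c * pauliBasis d).trace = if c = d then 2 else 0 := by
  rcases c with _ | c <;> rcases d with _ | d
  · simp [pauliBasis]
  · fin_cases d <;> simp [pauliBasis, pauli, Matrix.trace_fin_two]
  · fin_cases c <;> simp [pauliBasis, pauli, Matrix.trace_fin_two]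
  · fin_cases c <;> fin_cases d <;>
      simp [pauliBasis, pauli, Matrix.trace_fin_two, one_add_one_eq_two]

theorem trace_pauliString_mul (v w : Fin n → Option (Fin 3)) :
    (pauliString v * pauliString w).trace = if v = w then 2 ^ n else 0 := by
  simp only [pauliString, tensor_mul, trace_tensor, trace_pauliBasis_mul, Finset.prod_ite_zero,
    funext_iff, Finset.mem_univ, true_imp_iff, Finset.prod_const, Finset.card_univ,
    Fintype.card_fin]

theorem site_mul_site_eq_pauliString {i j : Fin n} (hij : i ≠ j) (a b : Fin 3) :
    site n a i * site n b j =
      pauliString (Function.update (Function.update (fun _ => none) i (some a)) j (some b)) := by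
  rw [site, site, tensor_mul, pauliString]
  congr 1
  funext k
  rcases eq_or_ne k j with rfl | hj
  · simp [pauliBasis, Function.update_of_ne hij.symm]
  · rcases eq_or_ne k i with rfl | hi
    · simp [pauliBasis, Function.update_of_ne hj]
    · simp [pauliBasis, Function.update_of_ne hi, Function.update_of_ne hj]

theorem hamiltonian_eq_sum_pauliString (hn : 2 ≤ n) (x : Coeff n) :
    hamiltonian n x = ∑ p, (x p : ℂ) • pauliString (bondWord p) := by
  simp only [hamiltonian, site_mul_site_eq_pauliString (finRotate_ne hn _)]
  rw [Fintype.sum_prod_type, Finset.sum_comm]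
  refine Finset.sum_congr rfl fun a _ => ?_
  rw [Fintype.sum_prod_type, Finset.sum_comm]
  rfl

theorem bondWord_eq_some_iff (hn : 2 ≤ n) {p : Fin 3 × Fin 3 × Fin n} {k : Fin n} {c : Fin 3} :
    bondWord p k = some c ↔ k = p.2.2 ∧ c = p.1 ∨ k = finRotate n p.2.2 ∧ c = p.2.1 := by
  have hne := finRotate_ne hn p.2.2
  simp only [bondWord, Function.update_apply]
  grind

/-- The second case occurs only in a chain of two sites, where each pair of neighbours carries two
bonds. -/
theorem eq_or_eq_swap_of_bondWord_eq (hn : 2 ≤ n) {p q : Fin 3 × Fin 3 × Fin n}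
    (h : bondWord p = bondWord q) : q = p ∨ q = (p.2.1, p.1, finRotate n p.2.2) := by
  have hp := finRotate_ne hn p.2.2
  have hfst : bondWord q p.2.2 = some p.1 := h ▸ (bondWord_eq_some_iff hn).2 (.inl ⟨rfl, rfl⟩)
  have hsnd : bondWord q (finRotate n p.2.2) = some p.2.1 :=
    h ▸ (bondWord_eq_some_iff hn).2 (.inr ⟨rfl, rfl⟩)
  rw [bondWord_eq_some_iff hn] at hfst hsnd
  grind

theorem card_bondWord_fiber_le (hn : 2 ≤ n) (p : Fin 3 × Fin 3 × Fin n) :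
    (Finset.univ.filter fun q => bondWord p = bondWord q).card ≤ 2 := by
  refine (Finset.card_le_card fun q hq => ?_).trans
    (Finset.card_le_two (a := p) (b := (p.2.1, p.1, finRotate n p.2.2)))
  simpa using eq_or_eq_swap_of_bondWord_eq hn (Finset.mem_filter.1 hq).2

theorem re_trace_hamiltonian_mul_self (hn : 2 ≤ n) (x : Coeff n) :
    (hamiltonian n x * hamiltonian n x).trace.re =
      2 ^ n * ∑ p, ∑ q, if bondWord p = bondWord q then x p * x q else 0 := by
  have hpq : ∀ p q, (x p : ℂ) * (x q : ℂ) * (if bondWord p = bondWord q then 2 ^ n else 0) =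
      ((2 ^ n * if bondWord p = bondWord q then x p * x q else 0 : ℝ) : ℂ) := fun p q => by
    split_ifs <;> push_cast <;> ring
  simp only [hamiltonian_eq_sum_pauliString hn, Finset.sum_mul_sum, smul_mul_smul_comm,
    Matrix.trace_sum, Matrix.trace_smul, smul_eq_mul, trace_pauliString_mul, hpq, Complex.re_sum,
    Complex.ofReal_re]
  simp only [Finset.mul_sum]

theorem re_trace_hamiltonian_mul_self_div_le (hn : 2 ≤ n) (x : Coeff n) :
    (hamiltonian n x * hamiltonian n x).trace.re / Fintype.card (Fin n → Fin 2) ≤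
      2 * ‖x‖ ^ 2 := by
  have hcard : (Fintype.card (Fin n → Fin 2) : ℝ) = 2 ^ n := by simp
  rw [re_trace_hamiltonian_mul_self hn, hcard, mul_div_cancel_left₀ _ (by positivity),
    EuclideanSpace.real_norm_sq_eq]
  exact sum_sum_ite_mul_le_of_card_fiber_le bondWord (card_bondWord_fiber_le hn) x

theorem hamiltonian_sub (x y : Coeff n) :
    hamiltonian n x - hamiltonian n y = hamiltonian n (x - y) := by
  simp only [hamiltonian, ← Finset.sum_sub_distrib, ← sub_smul, PiLp.sub_apply,
    Complex.ofReal_sub]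

end PauliStrings

section Empirical

variable {n : ℕ} {f : ℝ → ℝ}

instance isProbabilityMeasure_empirical (hn : 2 ≤ n) (x : Coeff n) :
    IsProbabilityMeasure (empirical hn x) :=
  spectralMeasure_prob _

theorem abs_integral_empirical_sub_le (hn : 2 ≤ n) {K : ℝ≥0} (hf : LipschitzWith K f)
    (x y : Coeff n) :
    |∫ z, f z ∂(empirical hn x) - ∫ z, f z ∂(empirical hn y)| ≤ 2 * K * ‖x - y‖ := by
  have hsqrt : √(2 * ‖x - y‖ ^ 2) ≤ 2 * ‖x - y‖ :=
    Real.sqrt_le_iff.2 ⟨by positivity, by nlinarith [sq_nonneg ‖x - y‖]⟩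
  refine (abs_integral_spectralMeasure_sub_le _ _ hf).trans ?_
  rw [hamiltonian_sub, mul_assoc, mul_left_comm]
  exact mul_le_mul_of_nonneg_left
    ((Real.sqrt_le_sqrt (re_trace_hamiltonian_mul_self_div_le hn _)).trans hsqrt) K.2

theorem lipschitzWith_integral_empirical (hn : 2 ≤ n) {K : ℝ≥0} (hf : LipschitzWith K f) :
    LipschitzWith (2 * K) fun x => ∫ z, f z ∂(empirical hn x) :=
  LipschitzWith.of_dist_le_mul fun x y => by
    rw [Real.dist_eq, dist_eq_norm]
    exact abs_integral_empirical_sub_le hn hf x y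

theorem lintegral_sq_empirical_le (hn : 2 ≤ n) (x : Coeff n) :
    ∫⁻ y, ENNReal.ofReal (y ^ 2) ∂(empirical hn x) ≤ ENNReal.ofReal (2 * ‖x‖ ^ 2) := by
  rw [empirical, ← ofReal_integral_eq_lintegral_ofReal (integrable_spectralMeasure _ _)
    (ae_of_all _ fun y => sq_nonneg y), integral_sq_spectralMeasure]
  exact ENNReal.ofReal_le_ofReal (re_trace_hamiltonian_mul_self_div_le hn x)

end Empirical

end SpinChain

section PiecewiseLinear

/-- The function that is `0` left of `c`, `δ` right of `c + δ`, and of slope `1` in between: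
the building block of piecewise linear functions on a grid of mesh `δ`. -/
def ramp (δ c x : ℝ) : ℝ := max 0 (min (x - c) δ)

/-- The slope of `f` on the `i`-th interval `[t + i δ, t + (i + 1) δ]` of the grid of mesh `δ`
starting at `t`. -/
noncomputable def gridSlope (f : ℝ → ℝ) (t δ : ℝ) (i : ℕ) : ℝ :=
  (f (t + (i + 1 : ℕ) * δ) - f (t + i * δ)) / δ

/-- The piecewise linear interpolation of `f` on the grid `t, t + δ, …, t + k δ`, extended by
constants outside `[t, t + k δ]`. -/
noncomputable def interpolant (f : ℝ → ℝ) (t δ : ℝ) (k : ℕ) (x : ℝ) : ℝ :=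
  f t + ∑ i ∈ Finset.range k, gridSlope f t δ i * ramp δ (t + i * δ) x

variable {f : ℝ → ℝ} {t δ : ℝ} {K : ℝ≥0}

theorem lipschitzWith_ramp (δ c : ℝ) : LipschitzWith 1 (ramp δ c) := by
  have h : LipschitzWith 1 fun x : ℝ => x - c :=
    LipschitzWith.of_dist_le_mul fun x y => by simp [Real.dist_eq]
  exact (h.min_const δ).const_max 0

theorem ramp_of_le {c x : ℝ} (h : x ≤ c) : ramp δ c x = 0 :=
  max_eq_left ((min_le_left _ _).trans (sub_nonpos.2 h))

theorem ramp_of_add_le {c x : ℝ} (hδ : 0 ≤ δ) (h : c + δ ≤ x) : ramp δ c x = δ := by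
  rw [ramp, min_eq_right (by linarith), max_eq_right hδ]

theorem abs_ramp_le (hδ : 0 ≤ δ) (c x : ℝ) : |ramp δ c x| ≤ δ := by
  rw [abs_of_nonneg (le_max_left _ _)]
  exact max_le hδ (min_le_right _ _)

theorem abs_gridSlope_le (hf : LipschitzWith K f) (hδ : 0 < δ) (i : ℕ) :
    |gridSlope f t δ i| ≤ K := by
  rw [gridSlope, abs_div, abs_of_pos hδ, div_le_iff₀ hδ]
  refine (hf.dist_le_mul (t + (i + 1 : ℕ) * δ) (t + i * δ)).trans_eq ?_
  rw [Real.dist_eq, show t + (i + 1 : ℕ) * δ - (t + i * δ) = δ by push_cast; ring, abs_of_pos hδ]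

theorem interpolant_succ (k : ℕ) (x : ℝ) :
    interpolant f t δ (k + 1) x =
      interpolant f t δ k x + gridSlope f t δ k * ramp δ (t + k * δ) x := by
  rw [interpolant, interpolant, Finset.sum_range_succ, add_assoc]

theorem interpolant_of_le (hδ : 0 ≤ δ) (k : ℕ) {x : ℝ} (hx : x ≤ t) :
    interpolant f t δ k x = f t := by
  rw [interpolant, Finset.sum_eq_zero, add_zero]
  intro i _
  have : 0 ≤ (i : ℝ) * δ := by positivity
  rw [ramp_of_le (by linarith), mul_zero]

theorem interpolant_of_ge (hδ : 0 < δ) (k : ℕ) {x : ℝ} (hx : t + k * δ ≤ x) :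
    interpolant f t δ k x = f (t + k * δ) := by
  induction k with
  | zero => simp [interpolant]
  | succ k ih =>
    have hk : t + (k + 1 : ℕ) * δ = t + k * δ + δ := by push_cast; ring
    rw [hk] at hx
    rw [interpolant_succ, ih (by linarith), ramp_of_add_le hδ.le hx, gridSlope,
      div_mul_cancel₀ _ hδ.ne', add_sub_cancel]

theorem abs_sub_interpolant_le (hf : LipschitzWith K f) (hδ : 0 < δ) (k : ℕ) {x : ℝ} (h1 : t ≤ x)
    (h2 : x ≤ t + k * δ) : |f x - interpolant f t δ k x| ≤ 2 * K * δ := by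
  induction k with
  | zero =>
    have : x = t := le_antisymm (by simpa using h2) h1
    rw [interpolant_of_le hδ.le _ this.le, this, sub_self, abs_zero]
    positivity
  | succ k ih =>
    rw [interpolant_succ]
    rcases le_total x (t + k * δ) with h | h
    · rw [ramp_of_le h, mul_zero, add_zero]
      exact ih h
    · rw [interpolant_of_ge hδ k h, ← sub_sub]
      have hxδ : |x - (t + k * δ)| ≤ δ := by
        push_cast at h2
        rw [abs_of_nonneg (sub_nonneg.2 h)]
        linarith
      have hincrement : |f x - f (t + k * δ)| ≤ K * δ :=
        (hf.dist_le_mul x (t + k * δ)).trans (by rw [Real.dist_eq]; gcongr)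
      have hslope : |gridSlope f t δ k * ramp δ (t + k * δ) x| ≤ K * δ := by
        rw [abs_mul]
        exact mul_le_mul (abs_gridSlope_le hf hδ k) (abs_ramp_le hδ.le _ _) (abs_nonneg _) K.2
      refine (abs_sub _ _).trans ?_
      linarith

theorem abs_sub_interpolant_le_add_sq (hf : LipschitzWith K f) {M : ℝ} (hb : ∀ x, |f x| ≤ M)
    {R : ℝ} (hR : 0 < R) (hδ : 0 < δ) {k : ℕ} (hk : k * δ = 2 * R) (x : ℝ) :
    |f x - interpolant f (-R) δ k x| ≤ 2 * K * δ + 2 * M / R ^ 2 * x ^ 2 := by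
  have hM : 0 ≤ M := (abs_nonneg _).trans (hb 0)
  have hK : 0 ≤ 2 * K * δ := by positivity
  have hfar : ∀ u, R ≤ |x| → |f x - f u| ≤ 2 * K * δ + 2 * M / R ^ 2 * x ^ 2 := fun u hx => by
    have hMsq : 2 * M ≤ 2 * M / R ^ 2 * x ^ 2 := by
      rw [div_mul_eq_mul_div, le_div_iff₀ (by positivity), ← sq_abs x]
      gcongr
    refine (abs_sub _ _).trans ?_
    linarith [hb x, hb u]
  rcases le_total x (-R) with h | h
  · rw [interpolant_of_le hδ.le _ h]
    exact hfar _ (by rw [abs_of_nonpos (by linarith)]; linarith)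
  · rcases le_total x R with h' | h'
    · refine (abs_sub_interpolant_le hf hδ k h (by rw [hk]; linarith)).trans ?_
      exact le_add_of_nonneg_right (by positivity)
    · rw [interpolant_of_ge hδ _ (by rw [hk]; linarith)]
      exact hfar _ (by rw [abs_of_nonneg (by linarith)]; linarith)

variable {μ : Measure ℝ} [IsFiniteMeasure μ]

theorem integrable_of_lipschitzWith_of_bounded (hf : LipschitzWith K f) {M : ℝ}
    (hb : ∀ x, |f x| ≤ M) : Integrable f μ :=
  (integrable_const M).mono' hf.continuous.aestronglyMeasurable (ae_of_all _ hb)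

theorem integrable_ramp (hδ : 0 ≤ δ) (c : ℝ) : Integrable (ramp δ c) μ :=
  integrable_of_lipschitzWith_of_bounded (lipschitzWith_ramp δ c) (abs_ramp_le hδ c)

theorem integrable_interpolant (hδ : 0 ≤ δ) (k : ℕ) : Integrable (interpolant f t δ k) μ :=
  (integrable_const _).add (integrable_finsetSum _ fun _ _ => (integrable_ramp hδ _).const_mul _)

theorem integral_interpolant (hδ : 0 ≤ δ) (k : ℕ) :
    ∫ x, interpolant f t δ k x ∂μ =
      μ.real Set.univ * f t +
        ∑ i ∈ Finset.range k, gridSlope f t δ i * ∫ x, ramp δ (t + i * δ) x ∂μ := by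
  have hi : ∀ i ∈ Finset.range k,
      Integrable (fun x => gridSlope f t δ i * ramp δ (t + i * δ) x) μ :=
    fun i _ => (integrable_ramp hδ _).const_mul _
  simp only [interpolant]
  rw [integral_add (integrable_const _) (integrable_finsetSum _ hi), integral_finsetSum _ hi]
  simp [integral_const_mul]

end PiecewiseLinear

section SecondMoment

variable {μ : Measure ℝ} {m : ℝ}

theorem integrable_sq_of_lintegral_sq_le
    (hμ : ∫⁻ y, ENNReal.ofReal (y ^ 2) ∂μ ≤ ENNReal.ofReal m) :
    Integrable (fun y : ℝ => y ^ 2) μ :=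
  (lintegral_ofReal_ne_top_iff_integrable (by fun_prop) (ae_of_all _ sq_nonneg)).1
    (ne_top_of_le_ne_top ENNReal.ofReal_ne_top hμ)

theorem integral_sq_le_of_lintegral_sq_le (hm : 0 ≤ m)
    (hμ : ∫⁻ y, ENNReal.ofReal (y ^ 2) ∂μ ≤ ENNReal.ofReal m) : ∫ y, y ^ 2 ∂μ ≤ m := by
  rw [integral_eq_lintegral_of_nonneg_ae (ae_of_all _ sq_nonneg) (by fun_prop)]
  exact ENNReal.toReal_le_of_le_ofReal hm hμ

theorem abs_integral_sub_le_of_abs_sub_le_add_sq [IsProbabilityMeasure μ] (hm : 0 ≤ m)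
    (hμ : ∫⁻ y, ENNReal.ofReal (y ^ 2) ∂μ ≤ ENNReal.ofReal m) {f g : ℝ → ℝ}
    (hf : Integrable f μ) (hg : Integrable g μ) {a b : ℝ} (hb : 0 ≤ b)
    (h : ∀ x, |f x - g x| ≤ a + b * x ^ 2) : |∫ x, f x ∂μ - ∫ x, g x ∂μ| ≤ a + b * m := by
  have hsq := integrable_sq_of_lintegral_sq_le hμ
  rw [← integral_sub hf hg]
  calc |∫ x, f x - g x ∂μ|
      ≤ ∫ x, a + b * x ^ 2 ∂μ :=
        norm_integral_le_of_norm_le (f := fun x => f x - g x) (g := fun x => a + b * x ^ 2)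
          ((integrable_const a).add (hsq.const_mul b)) (ae_of_all _ h)
    _ = a + b * ∫ x, x ^ 2 ∂μ := by
        rw [integral_add (integrable_const a) (hsq.const_mul b), integral_const_mul b]
        simp
    _ ≤ a + b * m := by
        gcongr
        exact integral_sq_le_of_lintegral_sq_le hm hμ

end SecondMoment

namespace SpinChain

section BoundedLipschitz

theorem abs_le_of_blNorm_le {f : ℝ → ℝ} {K : ℝ≥0} (hf : blNorm f ≤ K) (x : ℝ) : |f x| ≤ K := by
  have h : ‖f x‖ₑ ≤ K := (le_iSup (fun x => ‖f x‖ₑ) x).trans (le_self_add.trans hf)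
  rw [enorm_eq_nnnorm, ENNReal.coe_le_coe] at h
  exact h

theorem lipschitzWith_of_blNorm_le {f : ℝ → ℝ} {K : ℝ≥0} (hf : blNorm f ≤ K) :
    LipschitzWith K f := by
  intro x y
  rcases eq_or_ne x y with rfl | hxy
  · simp
  · have hL : edist (f x) (f y) / edist x y ≤ ⨅ (L : ℝ≥0) (_ : LipschitzWith L f), (L : ℝ≥0∞) :=
      le_iInf₂ fun L hL => ENNReal.div_le_of_le_mul (hL x y)
    rw [← ENNReal.div_le_iff (edist_pos.2 hxy).ne' (edist_ne_top x y)]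
    exact hL.trans (le_add_self.trans hf)

theorem blNorm_zero : blNorm (fun _ => 0) = 0 := by
  have h : ⨅ (K : ℝ≥0) (_ : LipschitzWith K fun _ : ℝ => (0 : ℝ)), (K : ℝ≥0∞) ≤ 0 :=
    (iInf₂_le (0 : ℝ≥0) (LipschitzWith.const 0)).trans (by simp)
  rw [blNorm, le_zero_iff.1 h]
  simp

variable {μ ν : Measure ℝ}

theorem dBL_le {c : ℝ}
    (h : ∀ f : ℝ → ℝ, blNorm f ≤ 1 → |∫ x, f x ∂μ - ∫ x, f x ∂ν| ≤ c) : dBL μ ν ≤ c := by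
  refine csSup_le ⟨_, fun _ => 0, by simp [blNorm_zero], rfl⟩ ?_
  rintro _ ⟨f, hf, rfl⟩
  exact h f hf

theorem abs_integral_le_one_of_blNorm_le_one [IsProbabilityMeasure μ] {f : ℝ → ℝ}
    (hf : blNorm f ≤ 1) : |∫ x, f x ∂μ| ≤ 1 := by
  simpa using norm_integral_le_of_norm_le_const (μ := μ) (f := f)
    (ae_of_all _ (abs_le_of_blNorm_le (K := 1) hf))

theorem abs_integral_sub_le_dBL [IsProbabilityMeasure μ] [IsProbabilityMeasure ν] {f : ℝ → ℝ}
    (hf : blNorm f ≤ 1) : |∫ x, f x ∂μ - ∫ x, f x ∂ν| ≤ dBL μ ν := by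
  refine le_csSup ⟨1 + 1, ?_⟩ ⟨f, hf, rfl⟩
  rintro _ ⟨g, hg, rfl⟩
  exact (abs_sub _ _).trans (add_le_add (abs_integral_le_one_of_blNorm_le_one hg)
    (abs_integral_le_one_of_blNorm_le_one hg))

theorem dBL_triangle (μ ν ρ : Measure ℝ) [IsProbabilityMeasure μ] [IsProbabilityMeasure ν]
    [IsProbabilityMeasure ρ] : dBL μ ρ ≤ dBL μ ν + dBL ν ρ :=
  dBL_le fun f hf => (abs_sub_le _ (∫ x, f x ∂ν) _).trans
    (add_le_add (abs_integral_sub_le_dBL hf) (abs_integral_sub_le_dBL hf))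

theorem abs_integral_interpolant_sub_le [IsProbabilityMeasure μ] [IsProbabilityMeasure ν]
    {f : ℝ → ℝ} {K : ℝ≥0} (hf : LipschitzWith K f) {δ : ℝ} (hδ : 0 < δ) (t : ℝ) (k : ℕ) :
    |∫ x, interpolant f t δ k x ∂μ - ∫ x, interpolant f t δ k x ∂ν| ≤
      K * ∑ i ∈ Finset.range k,
        |∫ x, ramp δ (t + i * δ) x ∂μ - ∫ x, ramp δ (t + i * δ) x ∂ν| := by
  rw [integral_interpolant hδ.le, integral_interpolant hδ.le, probReal_univ, probReal_univ,
    add_sub_add_left_eq_sub, ← Finset.sum_sub_distrib, Finset.mul_sum]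
  refine (Finset.abs_sum_le_sum_abs _ _).trans (Finset.sum_le_sum fun i _ => ?_)
  rw [← mul_sub, abs_mul]
  gcongr
  exact abs_gridSlope_le hf hδ i

theorem dBL_le_sum_ramp [IsProbabilityMeasure μ] [IsProbabilityMeasure ν] {m : ℝ} (hm : 0 ≤ m)
    (hμ : ∫⁻ y, ENNReal.ofReal (y ^ 2) ∂μ ≤ ENNReal.ofReal m)
    (hν : ∫⁻ y, ENNReal.ofReal (y ^ 2) ∂ν ≤ ENNReal.ofReal m)
    {R δ : ℝ} (hR : 0 < R) (hδ : 0 < δ) {k : ℕ} (hk : k * δ = 2 * R) :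
    dBL μ ν ≤ ∑ i ∈ Finset.range k,
      |∫ x, ramp δ (-R + i * δ) x ∂μ - ∫ x, ramp δ (-R + i * δ) x ∂ν| +
        (4 * δ + 4 / R ^ 2 * m) := by
  refine dBL_le fun f hf => ?_
  have hb : ∀ x, |f x| ≤ 1 := abs_le_of_blNorm_le (K := 1) hf
  have hl : LipschitzWith 1 f := lipschitzWith_of_blNorm_le (K := 1) hf
  set g := interpolant f (-R) δ k
  have happrox : ∀ (ρ : Measure ℝ) [IsProbabilityMeasure ρ],
      ∫⁻ y, ENNReal.ofReal (y ^ 2) ∂ρ ≤ ENNReal.ofReal m →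
        |∫ x, f x ∂ρ - ∫ x, g x ∂ρ| ≤ 2 * δ + 2 / R ^ 2 * m := fun ρ _ hρ => by
    simpa using abs_integral_sub_le_of_abs_sub_le_add_sq hm hρ
      (integrable_of_lipschitzWith_of_bounded hl hb) (integrable_interpolant hδ.le k)
      (by positivity) (abs_sub_interpolant_le_add_sq hl hb hR hδ hk)
  have hfμ := happrox μ hμ
  have hfν := happrox ν hν
  have hg := abs_integral_interpolant_sub_le (μ := μ) (ν := ν) hl hδ (-R) k
  rw [NNReal.coe_one, one_mul] at hg
  rw [abs_sub_comm] at hfν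
  calc |∫ x, f x ∂μ - ∫ x, f x ∂ν|
      ≤ |∫ x, f x ∂μ - ∫ x, g x ∂μ| + |∫ x, g x ∂μ - ∫ x, g x ∂ν| +
          |∫ x, g x ∂ν - ∫ x, f x ∂ν| :=
        (abs_sub_le _ _ _).trans (add_le_add_left (abs_sub_le _ _ _) _)
    _ ≤ _ := by linear_combination hfμ + hfν + hg

end BoundedLipschitz

end SpinChain

theorem integral_bind_of_measurable {α β : Type*} [MeasurableSpace α] [MeasurableSpace β]
    {μ : Measure α} {m : α → Measure β} (hm : Measurable m) {f : β → ℝ}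
    (hf : Integrable f (μ.bind m)) : ∫ y, f y ∂(μ.bind m) = ∫ x, ∫ y, f y ∂(m x) ∂μ := by
  let κ : Kernel α β := ⟨m, hm⟩
  have e : μ.bind m = (κ ∘ₖ Kernel.const Unit μ) () :=
    Measure.comp_eq_comp_const_apply (μ := μ) (κ := κ)
  rw [e] at hf ⊢
  exact Kernel.integral_comp hf

theorem summable_exp_neg_mul_natCast_rpow {c p : ℝ} (hc : 0 < c) (hp : 0 < p) :
    Summable fun n : ℕ => Real.exp (-c * (n : ℝ) ^ p) := by
  have hpow : Tendsto (fun n : ℕ => (n : ℝ) ^ p) atTop atTop :=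
    (tendsto_rpow_atTop hp).comp tendsto_natCast_atTop_atTop
  have hexp := ((isLittleO_exp_neg_mul_rpow_atTop hc (-2 / p)).comp_tendsto hpow).isBigO
  refine summable_of_isBigO_nat (Real.summable_nat_rpow.2 (by norm_num : (-2 : ℝ) < -1))
    (hexp.congr_right fun n => ?_)
  rw [Function.comp_apply, ← Real.rpow_mul n.cast_nonneg, mul_div_cancel₀ _ hp.ne']

theorem ae_eventually_notMem_of_hasLaw {Ω : Type*} [MeasurableSpace Ω] {P : Measure Ω}
    {E : ℕ → Type*} [∀ n, MeasurableSpace (E n)] {ν : ∀ n, Measure (E n)} {X : ∀ n, Ω → E n}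
    {S : ∀ n, Set (E n)} {b : ℕ → ℝ} {N : ℕ} (hX : ∀ n, N ≤ n → HasLaw (X n) (ν n) P)
    (hS : ∀ n, N ≤ n → MeasurableSet (S n)) (hb : Summable b)
    (hν : ∀ n, N ≤ n → ν n (S n) ≤ ENNReal.ofReal (b n)) :
    ∀ᵐ ω ∂P, ∀ᶠ n in atTop, X n ω ∉ S n := by
  have hP : ∀ n, P (X (n + N) ⁻¹' S (n + N)) ≤ ENNReal.ofReal (b (n + N)) := fun n => by
    have hN := Nat.le_add_left N n
    rw [← Measure.map_apply_of_aemeasurable (hX _ hN).aemeasurable (hS _ hN), (hX _ hN).map_eq]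
    exact hν _ hN
  have hsum : ∑' n, P (X (n + N) ⁻¹' S (n + N)) ≠ ∞ :=
    ne_top_of_le_ne_top ((summable_nat_add_iff N).2 hb).tsum_ofReal_ne_top
      (ENNReal.tsum_le_tsum hP)
  filter_upwards [ae_eventually_notMem hsum] with ω hω
  rw [← map_add_atTop_eq_nat N, eventually_map]
  exact hω

namespace SpinChain

section Concentration

variable {n : ℕ}

theorem sphereLaw_eq_unitSphereLaw (n : ℕ) : sphereLaw n = unitSphereLaw (Coeff n) :=
  rfl

theorem finrank_coeff (n : ℕ) : finrank ℝ (Coeff n) = 9 * n := by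
  rw [finrank_euclideanSpace]
  simp only [Fintype.card_prod, Fintype.card_fin]
  ring

theorem nontrivial_coeff (hn : 2 ≤ n) : Nontrivial (Coeff n) :=
  nontrivial_of_finrank_pos (R := ℝ) (by rw [finrank_coeff]; omega)

theorem integrable_sphereLaw_of_lipschitzWith (hn : 2 ≤ n) {F : Coeff n → ℝ} {K : ℝ≥0}
    (hF : LipschitzWith K F) : Integrable F (sphereLaw n) := by
  have := nontrivial_coeff hn
  rw [sphereLaw_eq_unitSphereLaw]
  exact integrable_unitSphereLaw_of_lipschitzWith hF

theorem hasSubgaussianMGF_sphereLaw_of_lipschitzWith (hn : 2 ≤ n) {F : Coeff n → ℝ} {K : ℝ≥0}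
    (hF : LipschitzWith K F) :
    HasSubgaussianMGF (fun x => F x - ∫ v, F v ∂(sphereLaw n)) ((8 * K) ^ 2 / n)
      (sphereLaw n) := by
  have := nontrivial_coeff hn
  have hc : (24 * K) ^ 2 / (finrank ℝ (Coeff n) : ℝ≥0) = (8 * K) ^ 2 / n := by
    rw [finrank_coeff, Nat.cast_mul, show (24 * K) ^ 2 = 9 * (8 * K) ^ 2 by ring]
    exact mul_div_mul_left _ _ (by norm_num)
  rw [sphereLaw_eq_unitSphereLaw, ← hc]
  exact hasSubgaussianMGF_unitSphereLaw_of_lipschitzWith hF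

theorem ae_lintegral_sq_empirical_le (hn : 2 ≤ n) :
    ∀ᵐ x ∂(sphereLaw n), ∫⁻ y, ENNReal.ofReal (y ^ 2) ∂(empirical hn x) ≤ ENNReal.ofReal 2 := by
  rw [sphereLaw_eq_unitSphereLaw]
  filter_upwards [ae_unitSphereLaw_norm_eq_one (E := Coeff n)] with x hx
  simpa [hx] using lintegral_sq_empirical_le hn x

theorem lintegral_sq_dos_le (hn : 2 ≤ n) :
    ∫⁻ y, ENNReal.ofReal (y ^ 2) ∂(dos hn) ≤ ENNReal.ofReal 2 := by
  have := sphereLaw_prob hn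
  rw [dos, Measure.lintegral_bind (measurable_empirical hn).aemeasurable (by fun_prop)]
  exact (lintegral_mono_ae (ae_lintegral_sq_empirical_le hn)).trans (by simp)

theorem integral_abs_integral_ramp_sub_le (hn : 2 ≤ n) {δ : ℝ} (hδ : 0 ≤ δ) (c : ℝ) :
    ∫ x, |∫ y, ramp δ c y ∂(empirical hn x) - ∫ y, ramp δ c y ∂(dos hn)| ∂(sphereLaw n) ≤
      48 / √n := by
  have := sphereLaw_prob hn
  have := dos_prob hn
  have : (0 : ℝ≥0) < n := Nat.cast_pos.2 (by omega)
  have hdos : ∫ y, ramp δ c y ∂(dos hn) =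
      ∫ x, ∫ y, ramp δ c y ∂(empirical hn x) ∂(sphereLaw n) :=
    integral_bind_of_measurable (measurable_empirical hn) (integrable_ramp (μ := dos hn) hδ c)
  have hsub := hasSubgaussianMGF_sphereLaw_of_lipschitzWith hn
    (lipschitzWith_integral_empirical hn (lipschitzWith_ramp δ c))
  rw [hdos]
  refine (integral_abs_le_of_hasSubgaussianMGF hsub (by positivity)).trans_eq ?_
  push_cast
  rw [Real.sqrt_div (by positivity), Real.sqrt_sq (by norm_num)]
  ring

theorem lipschitzWith_dBL (hn : 2 ≤ n) :
    LipschitzWith 2 fun x => dBL (empirical hn x) (dos hn) := by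
  have := dos_prob hn
  refine LipschitzWith.of_le_add_mul _ fun x y => ?_
  have hxy : dBL (empirical hn x) (empirical hn y) ≤ 2 * dist x y := dBL_le fun f hf => by
    simpa [dist_eq_norm] using
      abs_integral_empirical_sub_le hn (lipschitzWith_of_blNorm_le (K := 1) hf) x y
  push_cast
  linarith [dBL_triangle (empirical hn x) (empirical hn y) (dos hn)]

theorem integrable_dBL (hn : 2 ≤ n) :
    Integrable (fun x => dBL (empirical hn x) (dos hn)) (sphereLaw n) :=
  integrable_sphereLaw_of_lipschitzWith hn (lipschitzWith_dBL hn)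

theorem integral_dBL_le_of_grid (hn : 2 ≤ n) {R : ℝ} (hR : 0 < R) {k : ℕ} (hk : 0 < k) :
    ∫ x, dBL (empirical hn x) (dos hn) ∂(sphereLaw n) ≤
      k * (48 / √n) + (8 * R / k + 8 / R ^ 2) := by
  have := sphereLaw_prob hn
  have := dos_prob hn
  have hk0 : (0 : ℝ) < k := Nat.cast_pos.2 hk
  set δ : ℝ := 2 * R / k with hδ
  have hδ0 : 0 < δ := by positivity
  have hkδ : k * δ = 2 * R := mul_div_cancel₀ _ hk0.ne'
  set Y : ℕ → Coeff n → ℝ := fun i x => |∫ y, ramp δ (-R + i * δ) y ∂(empirical hn x) -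
    ∫ y, ramp δ (-R + i * δ) y ∂(dos hn)|
  have hY : ∀ i ∈ Finset.range k, Integrable (Y i) (sphereLaw n) := fun i _ =>
    ((integrable_sphereLaw_of_lipschitzWith hn
      (lipschitzWith_integral_empirical hn (lipschitzWith_ramp _ _))).sub (integrable_const _)).abs
  have hS : Integrable (fun x => ∑ i ∈ Finset.range k, Y i x) (sphereLaw n) :=
    integrable_finsetSum _ hY
  calc ∫ x, dBL (empirical hn x) (dos hn) ∂(sphereLaw n)
      ≤ ∫ x, (∑ i ∈ Finset.range k, Y i x + (4 * δ + 4 / R ^ 2 * 2)) ∂(sphereLaw n) := by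
        refine integral_mono_ae (integrable_dBL hn) (hS.add (integrable_const _)) ?_
        filter_upwards [ae_lintegral_sq_empirical_le hn] with x hx
        exact dBL_le_sum_ramp zero_le_two hx (lintegral_sq_dos_le hn) hR hδ0 hkδ
    _ = ∑ i ∈ Finset.range k, ∫ x, Y i x ∂(sphereLaw n) + (4 * δ + 4 / R ^ 2 * 2) := by
        rw [integral_add hS (integrable_const _), integral_finsetSum _ hY]
        simp
    _ ≤ ∑ i ∈ Finset.range k, 48 / √n + (4 * δ + 4 / R ^ 2 * 2) := by
        gcongr
        exact integral_abs_integral_ramp_sub_le hn hδ0.le _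
    _ = k * (48 / √n) + (8 * R / k + 8 / R ^ 2) := by
        rw [Finset.sum_const, Finset.card_range, nsmul_eq_mul, hδ]
        ring

/-- With `u = n ^ (1 / 12)`, the choices `R = u` and `k ≈ u ^ 3` balance the three error terms of
`integral_dBL_le_of_grid` at order `u ^ (-2)`. -/
theorem integral_dBL_le (hn : 2 ≤ n) :
    ∫ x, dBL (empirical hn x) (dos hn) ∂(sphereLaw n) ≤ 112 / (n : ℝ) ^ (1 / 6 : ℝ) := by
  have hn1 : (1 : ℝ) ≤ n := by exact_mod_cast (by omega : 1 ≤ n)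
  set u : ℝ := (n : ℝ) ^ (1 / 12 : ℝ) with hu
  have hu1 : 1 ≤ u := Real.one_le_rpow hn1 (by norm_num)
  have hpow : ∀ m : ℕ, u ^ m = (n : ℝ) ^ (m / 12 : ℝ) := fun m => by
    rw [hu, ← Real.rpow_natCast, ← Real.rpow_mul (by positivity), one_div_mul_eq_div]
  have hsqrt : √(n : ℝ) = u ^ 6 := by
    rw [hpow, Real.sqrt_eq_rpow]
    norm_num
  have hsixth : (n : ℝ) ^ (1 / 6 : ℝ) = u ^ 2 := by
    rw [hpow]
    norm_num
  set k : ℕ := ⌈u ^ 3⌉₊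
  have hk : u ^ 3 ≤ k := Nat.le_ceil _
  have hk2 : (k : ℝ) ≤ 2 * u ^ 3 := by
    linarith [Nat.ceil_lt_add_one (show 0 ≤ u ^ 3 by positivity), one_le_pow₀ hu1 (n := 3)]
  rw [hsixth]
  calc ∫ x, dBL (empirical hn x) (dos hn) ∂(sphereLaw n)
      ≤ k * (48 / √n) + (8 * u / k + 8 / u ^ 2) :=
        integral_dBL_le_of_grid hn (by positivity) (Nat.ceil_pos.2 (by positivity))
    _ ≤ 2 * u ^ 3 * (48 / u ^ 5) + (8 * u / u ^ 3 + 8 / u ^ 2) := by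
        rw [hsqrt]
        gcongr
        norm_num
    _ = 112 / u ^ 2 := by
        field_simp
        norm_num

theorem dBL_tail_le (hn : 2 ≤ n) {t : ℝ} (ht : 0 ≤ t) :
    (sphereLaw n).real {x | 112 / (n : ℝ) ^ (1 / 6 : ℝ) + t ≤ dBL (empirical hn x) (dos hn)} ≤
      Real.exp (-(1 / 512) * n * t ^ 2) := by
  have := sphereLaw_prob hn
  have hsub : {x | 112 / (n : ℝ) ^ (1 / 6 : ℝ) + t ≤ dBL (empirical hn x) (dos hn)} ⊆
      {x | t ≤ dBL (empirical hn x) (dos hn) -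
        ∫ v, dBL (empirical hn v) (dos hn) ∂(sphereLaw n)} := fun x hx => by
    rw [Set.mem_ofPred_eq] at hx ⊢
    linarith [integral_dBL_le hn]
  refine (measureReal_mono hsub).trans
    (((hasSubgaussianMGF_sphereLaw_of_lipschitzWith hn (lipschitzWith_dBL hn)).measure_ge_le
      ht).trans_eq ?_)
  push_cast
  congr 1
  field_simp
  ring

theorem ae_eventually_dBL_le {Ω : Type*} [MeasurableSpace Ω] {P : Measure Ω}
    {X : (n : ℕ) → Ω → Coeff n} (hX : ∀ n : ℕ, 2 ≤ n → HasLaw (X n) (sphereLaw n) P) :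
    ∀ᵐ ω ∂P, ∀ᶠ n : ℕ in atTop, ∀ hn : 2 ≤ n,
      dBL (empirical hn (X n ω)) (dos hn) ≤ 113 / (n : ℝ) ^ (1 / 6 : ℝ) := by
  set S : (n : ℕ) → Set (Coeff n) := fun n => {x | ∃ hn : 2 ≤ n,
    112 / (n : ℝ) ^ (1 / 6 : ℝ) + 1 / (n : ℝ) ^ (1 / 6 : ℝ) ≤ dBL (empirical hn x) (dos hn)} with hS
  have hS_eq : ∀ n (hn : 2 ≤ n), S n = {x | 112 / (n : ℝ) ^ (1 / 6 : ℝ) +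
      1 / (n : ℝ) ^ (1 / 6 : ℝ) ≤ dBL (empirical hn x) (dos hn)} := fun n hn => by
    simp only [hS, exists_prop_of_true hn]
  have hmeas : ∀ n, 2 ≤ n → MeasurableSet (S n) := fun n hn => by
    rw [hS_eq n hn]
    exact measurableSet_le measurable_const (lipschitzWith_dBL hn).continuous.measurable
  have hbound : ∀ n, 2 ≤ n →
      sphereLaw n (S n) ≤ ENNReal.ofReal (Real.exp (-(1 / 512) * (n : ℝ) ^ (2 / 3 : ℝ))) := by
    intro n hn
    have := sphereLaw_prob hn
    have hn0 : (0 : ℝ) < n := Nat.cast_pos.2 (by omega)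
    have hpow : n * (1 / (n : ℝ) ^ (1 / 6 : ℝ)) ^ 2 = (n : ℝ) ^ (2 / 3 : ℝ) := by
      rw [one_div_pow, ← Real.rpow_natCast, ← Real.rpow_mul hn0.le, mul_one_div,
        ← Real.rpow_one_sub' hn0.le (by norm_num)]
      norm_num
    rw [hS_eq n hn, ← ofReal_measureReal, ← hpow, ← mul_assoc]
    exact ENNReal.ofReal_le_ofReal (dBL_tail_le hn (by positivity))
  filter_upwards [ae_eventually_notMem_of_hasLaw hX hmeas
    (summable_exp_neg_mul_natCast_rpow (by norm_num) (by norm_num)) hbound] with ω hω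
  filter_upwards [hω] with n hnω hn
  rw [hS_eq n hn, Set.mem_ofPred_eq, not_le, ← add_div] at hnω
  norm_num at hnω ⊢
  exact hnω.le

end Concentration

end SpinChain

theorem theorem13 :
    ∃ C C' c : ℝ, 0 < C ∧ 0 < C' ∧ 0 < c ∧
      (∀ (n : ℕ) (hn : 2 ≤ n),
        Integrable (fun x => SpinChain.dBL (SpinChain.empirical hn x) (SpinChain.dos hn))
            (SpinChain.sphereLaw n) ∧
          ∫ x, SpinChain.dBL (SpinChain.empirical hn x) (SpinChain.dos hn)
              ∂(SpinChain.sphereLaw n) ≤ C / (n : ℝ) ^ (1 / 6 : ℝ)) ∧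
      (∀ (n : ℕ) (hn : 2 ≤ n) (t : ℝ), 0 ≤ t →
        (SpinChain.sphereLaw n).real
            {x | C / (n : ℝ) ^ (1 / 6 : ℝ) + t ≤
              SpinChain.dBL (SpinChain.empirical hn x) (SpinChain.dos hn)} ≤
          C * Real.exp (-c * n * t ^ 2)) ∧
      (∀ (Ω : Type*) [MeasurableSpace Ω] (P : Measure Ω) [IsProbabilityMeasure P]
        (X : (n : ℕ) → Ω → SpinChain.Coeff n),
        (∀ n : ℕ, 2 ≤ n → HasLaw (X n) (SpinChain.sphereLaw n) P) →
          ∀ᵐ ω ∂P, ∀ᶠ n : ℕ in atTop, ∀ hn : 2 ≤ n,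
            SpinChain.dBL (SpinChain.empirical hn (X n ω)) (SpinChain.dos hn) ≤
              C' / (n : ℝ) ^ (1 / 6 : ℝ)) := by
  refine ⟨112, 113, 1 / 512, by norm_num, by norm_num, by norm_num,
    fun n hn => ⟨SpinChain.integrable_dBL hn, SpinChain.integral_dBL_le hn⟩,
    fun n hn t ht => (SpinChain.dBL_tail_le hn ht).trans ?_,
    fun Ω _ P _ X hX => SpinChain.ae_eventually_dBL_le hX⟩
  exact le_mul_of_one_le_left (Real.exp_pos _).le (by norm_num)
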